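/- All members of a family of graphs are finite graphs. "$G$ is $\mathcal F$-free" means that $G$ contains no member of $\mathcal F$ as a (not necessarily induced) subgraph; $e(G)$ is the number of edges and $\lambda(G)$ the largest eigenvalue of the adjacency matrix of $G$; $\overline{K_m}$ is the graph with $m$ vertices and no edges; $G+H$ is the join, $G\cup H$ the disjoint union, and $\infty\cdot G$ the disjoint union of countably many copies of $G$; $K_{m,\infty}$ is the complete bipartite graph with one part of size $m$ and the other countably infinite. Let $\mathrm{ex}(n,\mathcal F)$ be the maximum number of edges of an $\mathcal F$-free graph on $n$ vertices, let $\mathrm{SPEX}(n,\mathcal F)$ be the set of $\mathcal F$-free graphs on $n$ vertices that maximize $\lambda$, and, for a graph $K$, let $\mathrm{EX}^{K}(n,\mathcal F)$ be the set of graphs with the maximum number of edges among the $\mathcal F$-free graphs on $n$ vertices that contain a copy of $K$. **Proposition.** Let $\mathcal F$ be a family of graphs and $k\ge 1$ an integer. Suppose that $\mathrm{ex}(n,\mathcal F)=O(n)$, that $K_{k+1,\infty}$ is not $\mathcal F$-free, and that for all sufficiently large $n$ there is given a graph $H=H_n\in\mathrm{EX}^{K_{k,n-k}}(n,\mathcal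 F)$, where one of the following holds (the same one for all large $n$): (a) $H=K_{k,n-k}$; (b) $H=K_k+\overline{K_{n-k}}$; (c) $H=K_k+(K_2\cup\overline{K_{n-k-2}})$; (d) $\mathcal F$ is finite and $H=K_k+X$ with $e(X)\le Qn+O(1)$ for some constant $Q\in[0,3/4)$; (e) $\mathcal F$ is finite and $H=K_k+X$ with $e(X)\le Qn+O(1)$ for some constant $Q\in[3/4,\infty)$; (f) (e) holds, and for some constant $d$ all but a bounded number of vertices of $X$ have degree $d$, and $K_k+(\infty\cdot K_{1,d+1})$ is not $\mathcal F$-free. Then for all sufficiently large $n$, every $G\in\mathrm{SPEX}(n,\mathcal F)$ contains $K_{k,n-k}$ as a subgraph. Moreover, for every $\eta\in(0,1)$, if $n$ is sufficiently large, $G\in\mathrm{SPEX}(n,\mathcal F)$, and $x$ is a Perron eigenvector of $G$ (a nonnegative eigenvector for $\lambda(G)$, scaled so that its greatest entry is $1$), then exactly $k$ vertices $v$ satisfy $x_v\ge\eta$, and each of them is adjacent to every vertex $u$ with $x_u<\eta$. -/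

import Mathlib

open Filter Asymptotics SimpleGraph

/-- A family of finite graphs, each given on a vertex set `Fin m`. -/
abbrev GraphFamily := Set (Σ m : ℕ, SimpleGraph (Fin m))

/-- `G` (possibly infinite) contains no member of `ℱ` as a (not necessarily induced) subgraph. -/
def FamilyFree (ℱ : GraphFamily) {V : Type*} (G : SimpleGraph V) : Prop :=
  ∀ F ∈ ℱ, F.2.Free G

open Classical in
/-- The number of edges of a finite graph. -/
noncomputable def edgeCount {V : Type*} [Fintype V] (G : SimpleGraph V) : ℕ :=
  G.edgeFinset.card

open Classical in
/-- `ex(n, ℱ)`: the maximum number of edges of an `ℱ`-free graph on `n` vertices. -/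
noncomputable def exNumber (n : ℕ) (ℱ : GraphFamily) : ℕ :=
  (Finset.univ.filter fun G : SimpleGraph (Fin n) => FamilyFree ℱ G).sup edgeCount

/-- `EX^K(n, ℱ)`: the `ℱ`-free graphs on `n` vertices that contain a copy of `K` and have the
maximum number of edges among all such graphs. -/
def EXContaining {W : Type*} (K : SimpleGraph W) (n : ℕ) (ℱ : GraphFamily) :
    Set (SimpleGraph (Fin n)) :=
  {G | FamilyFree ℱ G ∧ K ⊑ G ∧
    ∀ G' : SimpleGraph (Fin n), FamilyFree ℱ G' → K ⊑ G' → edgeCount G' ≤ edgeCount G}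

open Classical in
/-- `λ(G)`: the largest eigenvalue of the adjacency matrix of `G`. -/
noncomputable def lambdaOne {n : ℕ} (G : SimpleGraph (Fin n)) : ℝ :=
  sSup (spectrum ℝ (G.adjMatrix ℝ))

/-- `SPEX(n, ℱ)`: the `ℱ`-free graphs on `n` vertices with the largest spectral radius. -/
def SPEX (n : ℕ) (ℱ : GraphFamily) : Set (SimpleGraph (Fin n)) :=
  {G | FamilyFree ℱ G ∧
    ∀ G' : SimpleGraph (Fin n), FamilyFree ℱ G' → lambdaOne G' ≤ lambdaOne G}

open Classical in
/-- `x` is a Perron eigenvector of `G`: a nonnegative eigenvector for `λ(G)`, scaled so that its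
greatest entry is `1`. -/
def IsPerronVector {n : ℕ} (G : SimpleGraph (Fin n)) (x : Fin n → ℝ) : Prop :=
  (G.adjMatrix ℝ).mulVec x = lambdaOne G • x ∧
    (∀ v, 0 ≤ x v) ∧ (∀ v, x v ≤ 1) ∧ ∃ z, x z = 1

/-- The join `G + H`: the disjoint union of `G` and `H` together with all edges between them. -/
def graphJoin {V W : Type*} (G : SimpleGraph V) (H : SimpleGraph W) : SimpleGraph (V ⊕ W) :=
  completeBipartiteGraph V W ⊔ (G ⊕g H)

/-- `∞ · G`: the disjoint union of countably many copies of `G`. -/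
def infCopies {V : Type*} (G : SimpleGraph V) : SimpleGraph (ℕ × V) :=
  (⊥ : SimpleGraph ℕ) □ G

/-- `H n = K_{k,n-k}` for all large `n`. -/
def CaseA (k : ℕ) (H : ∀ n, SimpleGraph (Fin n)) : Prop :=
  ∀ᶠ n in atTop, Nonempty (H n ≃g completeBipartiteGraph (Fin k) (Fin (n - k)))

/-- `H n` is the join of `K_k` and an independent set, for all large `n`. -/
def CaseB (k : ℕ) (H : ∀ n, SimpleGraph (Fin n)) : Prop :=
  ∀ᶠ n in atTop,
    Nonempty (H n ≃g graphJoin (⊤ : SimpleGraph (Fin k)) (⊥ : SimpleGraph (Fin (n - k))))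

/-- `H n` is the join of `K_k` and the disjoint union of one edge and `n - k - 2` isolated
vertices, for all large `n`. -/
def CaseC (k : ℕ) (H : ∀ n, SimpleGraph (Fin n)) : Prop :=
  ∀ᶠ n in atTop,
    Nonempty (H n ≃g graphJoin (⊤ : SimpleGraph (Fin k))
      ((⊤ : SimpleGraph (Fin 2)) ⊕g (⊥ : SimpleGraph (Fin (n - k - 2)))))

/-- `H n = K_k + X n` for all large `n`, where `e(X n) ≤ Q n + O(1)`. -/
def IsJoinWith (k : ℕ) (H : ∀ n, SimpleGraph (Fin n)) (X : ∀ n, SimpleGraph (Fin (n - k)))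
    (Q : ℝ) : Prop :=
  (∀ᶠ n in atTop, Nonempty (H n ≃g graphJoin (⊤ : SimpleGraph (Fin k)) (X n))) ∧
    ∃ B : ℝ, ∀ᶠ n : ℕ in atTop, (edgeCount (X n) : ℝ) ≤ Q * n + B

/-- The family is finite, and `H n = K_k + X n` with `e(X n) ≤ Q n + O(1)`, `0 ≤ Q < 3/4`. -/
def CaseD (ℱ : GraphFamily) (k : ℕ) (H : ∀ n, SimpleGraph (Fin n)) : Prop :=
  ℱ.Finite ∧ ∃ (X : ∀ n, SimpleGraph (Fin (n - k))) (Q : ℝ),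
    0 ≤ Q ∧ Q < 3 / 4 ∧ IsJoinWith k H X Q

/-- The family is finite, and `H n = K_k + X n` with `e(X n) ≤ Q n + O(1)`, `3/4 ≤ Q`. -/
def CaseE (ℱ : GraphFamily) (k : ℕ) (H : ∀ n, SimpleGraph (Fin n)) : Prop :=
  ℱ.Finite ∧ ∃ (X : ∀ n, SimpleGraph (Fin (n - k))) (Q : ℝ), 3 / 4 ≤ Q ∧ IsJoinWith k H X Q

open Classical in
/-- As in `CaseE`; moreover all but a bounded number of vertices of `X n` have the same degree
`d` (not depending on `n`), and `K_k + (∞ · K_{1,d+1})` is not `ℱ`-free. -/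
def CaseF (ℱ : GraphFamily) (k : ℕ) (H : ∀ n, SimpleGraph (Fin n)) : Prop :=
  ℱ.Finite ∧ ∃ (X : ∀ n, SimpleGraph (Fin (n - k))) (Q : ℝ),
    3 / 4 ≤ Q ∧ IsJoinWith k H X Q ∧
    ∃ d : ℕ,
      (∃ B : ℕ, ∀ᶠ n in atTop, (Finset.univ.filter fun v => (X n).degree v ≠ d).card ≤ B) ∧
      ¬ FamilyFree ℱ (graphJoin (⊤ : SimpleGraph (Fin k))
          (infCopies (completeBipartiteGraph (Fin 1) (Fin (d + 1)))))

/-! Let `G` be spectrally extremal with Perron vector `x` and λ = λ(G). Since `H n` is `ℱ`-free and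
contains K_{k,n-k}, λ² ≥ k(n-k). Linearity of ex(n, ℱ) makes every vertex set S span O(|S|) edges,
and a member of `ℱ` inside K_{k+1,∞} already lies in some K_{k+1,m}, so any k+1 vertices have fewer
than m common neighbours. `SparsePerron` collects these facts.

Large entries. In λ² x_v = Σ_w codeg(v,w) x_w the entries below ε contribute at most 2Cεn. Only
boundedly many entries exceed ε (`exists_card_large_le`), and all but boundedly many vertices have
at most k neighbours among these. Hence k(n-k) x_v ≤ k deg(v) + 2Cεn + O(1), that is, deg(v) ≥ (x_v
- o(1)) n. At a vertex z with x_z = 1 this estimate is almost tight; an entry x_w that is not small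
shares linearly many neighbours with z, so it must be close to 1 (`eventually_near_one`). There are
at most k such entries, as k+1 of them would have n/2 common neighbours, and at least k, as fewer
could not account for λ² (`eventually_large_entries`).

Completeness. Let L be these k vertices, R their common neighbourhood and E the rest. Use `x` as a
test vector for an `ℱ`-free `G'` that has all edges between L and its complement. The new edges
between L and E gain at least Σ_E x in the quadratic form, while the edges lost at E cost only a
small multiple of Σ_E x. If `G'` is no worse inside L and inside R, maximality of λ(G) forces E to
be empty (`full_of_comparison`).

The cases differ only in the choice of `G'` (`HasComparison`). In (a), (b), (c) it is `H n` with its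
k-part placed on L, and the extremality of the graph of order k+|R| bounds the edges of `G` inside L
and R. For finite families, `G'` is `G` with the vertices of E detached and joined to L only. -/

/-! ### Indicator of adjacency and its sums -/

open Classical in
/-- The `0`-`1` indicator of adjacency. -/
noncomputable def adjInd {V : Type*} (G : SimpleGraph V) (u v : V) : ℝ :=
  if G.Adj u v then 1 else 0

section AdjInd

variable {V : Type*} (G : SimpleGraph V)

lemma adjInd_comm (u v : V) : adjInd G u v = adjInd G v u := by
  classical exact if_congr (G.adj_comm u v) rfl rfl

lemma adjInd_nonneg (u v : V) : 0 ≤ adjInd G u v := by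
  unfold adjInd; split_ifs <;> norm_num

lemma adjInd_le_one (u v : V) : adjInd G u v ≤ 1 := by
  unfold adjInd; split_ifs <;> norm_num

lemma adjInd_self (u : V) : adjInd G u u = 0 := by simp [adjInd]

variable {G}

lemma adjInd_of_adj {u v : V} (h : G.Adj u v) : adjInd G u v = 1 := by simp [adjInd, h]

lemma adjInd_of_not_adj {u v : V} (h : ¬ G.Adj u v) : adjInd G u v = 0 := by simp [adjInd, h]

lemma adjInd_iso {W : Type*} {K : SimpleGraph W} (e : G ≃g K) (u v : V) :
    adjInd K (e u) (e v) = adjInd G u v := by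
  classical exact if_congr e.map_adj_iff rfl rfl

open Classical in
lemma sum_adjInd_eq_card (G : SimpleGraph V) (S : Finset V) (u : V) :
    ∑ v ∈ S, adjInd G u v = ((S.filter fun v => G.Adj u v).card : ℝ) := by
  simp [adjInd]

lemma sum_adjInd_le_card (G : SimpleGraph V) (S : Finset V) (u : V) :
    ∑ v ∈ S, adjInd G u v ≤ S.card := by
  calc _ ≤ ∑ v ∈ S, (1 : ℝ) := Finset.sum_le_sum fun v _ => adjInd_le_one G u v
    _ = _ := by simp

open Classical in
lemma two_mul_edgeCount [Fintype V] (G : SimpleGraph V) :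
    2 * (edgeCount G : ℝ) = ∑ u, ∑ v, adjInd G u v := by
  have h := G.sum_degrees_eq_twice_card_edges
  have h2 : ∀ u, ∑ v, adjInd G u v = (G.degree u : ℝ) := by
    intro u
    rw [sum_adjInd_eq_card, ← G.card_neighborFinset_eq_degree, neighborFinset_eq_filter]
  simp_rw [h2, edgeCount]
  exact_mod_cast h.symm

end AdjInd

/-! ### Graphs with a large eigenvalue, few edges and no large `K_{k+1,m}` -/

/-- `x` is a nonnegative eigenvector of `G`, with greatest entry `1`, for the eigenvalue `lam`,
which satisfies `lam² ≥ k (n - k)`; every vertex set `S` spans at most `C |S|` edges, and any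
`k + 1` vertices have fewer than `m` common neighbours. -/
structure SparsePerron {V : Type*} [Fintype V] (k m : ℕ) (C : ℝ) (G : SimpleGraph V)
    (lam : ℝ) (x : V → ℝ) : Prop where
  eig : ∀ v, lam * x v = ∑ u, adjInd G v u * x u
  nonneg : ∀ v, 0 ≤ x v
  le_one : ∀ v, x v ≤ 1
  exists_one : ∃ z, x z = 1
  lam_nonneg : 0 ≤ lam
  lam_sq : (k : ℝ) * (Fintype.card V - k) ≤ lam ^ 2
  sparse : ∀ S : Finset V, ∑ u ∈ S, ∑ v ∈ S, adjInd G u v ≤ 2 * C * S.card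
  common : ∀ T N : Finset V, T.card = k + 1 → (∀ t ∈ T, ∀ u ∈ N, G.Adj t u) → N.card < m

/-- The number of common neighbours. -/
noncomputable def codeg {V : Type*} [Fintype V] (G : SimpleGraph V) (v w : V) : ℝ :=
  ∑ u, adjInd G v u * adjInd G u w

/-- The degree, as a real number. -/
noncomputable def rdeg {V : Type*} [Fintype V] (G : SimpleGraph V) (v : V) : ℝ :=
  ∑ u, adjInd G v u

section Counting

variable {V : Type*} [Fintype V] {G : SimpleGraph V}

lemma rdeg_nonneg (G : SimpleGraph V) (v : V) : 0 ≤ rdeg G v :=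
  Finset.sum_nonneg fun _ _ => adjInd_nonneg G _ _

lemma rdeg_le_card (G : SimpleGraph V) (v : V) : rdeg G v ≤ Fintype.card V :=
  sum_adjInd_le_card G Finset.univ v

lemma codeg_nonneg (G : SimpleGraph V) (v w : V) : 0 ≤ codeg G v w :=
  Finset.sum_nonneg fun _ _ => mul_nonneg (adjInd_nonneg G _ _) (adjInd_nonneg G _ _)

lemma codeg_le_card (G : SimpleGraph V) (v w : V) : codeg G v w ≤ Fintype.card V := by
  calc _ ≤ ∑ u : V, (1 : ℝ) := Finset.sum_le_sum fun u _ =>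
        mul_le_one₀ (adjInd_le_one G _ _) (adjInd_nonneg G _ _) (adjInd_le_one G _ _)
    _ = _ := by simp

/-- Inclusion-exclusion for the two neighbourhoods. -/
lemma rdeg_add_rdeg_le (G : SimpleGraph V) (v w : V) :
    rdeg G v + rdeg G w - Fintype.card V ≤ codeg G v w := by
  have : rdeg G v + rdeg G w - Fintype.card V
      = ∑ u : V, (adjInd G v u + adjInd G w u - 1) := by
    simp [rdeg, Finset.sum_add_distrib]
  rw [this]
  refine Finset.sum_le_sum fun u _ => ?_
  rw [adjInd_comm G u w]
  nlinarith [adjInd_le_one G v u, adjInd_le_one G w u,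
    mul_nonneg (sub_nonneg.2 (adjInd_le_one G v u)) (sub_nonneg.2 (adjInd_le_one G w u))]

lemma sum_codeg (G : SimpleGraph V) (W : Finset V) (v : V) :
    ∑ w ∈ W, codeg G v w = ∑ u, adjInd G v u * ∑ w ∈ W, adjInd G u w := by
  simp_rw [codeg, Finset.mul_sum]
  exact Finset.sum_comm

variable {k m : ℕ} {C lam : ℝ} {x : V → ℝ}

lemma SparsePerron.sum_rdeg_le (h : SparsePerron k m C G lam x) :
    ∑ v, rdeg G v ≤ 2 * C * Fintype.card V := by
  simpa [rdeg] using h.sparse Finset.univ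

/-- The eigenvalue equation applied twice, so that the hypothesis on λ² can be used directly. -/
lemma SparsePerron.sq_mul (h : SparsePerron k m C G lam x) (v : V) :
    lam ^ 2 * x v = ∑ w, codeg G v w * x w := by
  have : lam ^ 2 * x v = ∑ u, adjInd G v u * (lam * x u) := by
    rw [pow_two, mul_assoc, h.eig v, Finset.mul_sum]
    exact Finset.sum_congr rfl fun u _ => by ring
  rw [this]
  simp_rw [h.eig, codeg, Finset.mul_sum, Finset.sum_mul]
  rw [Finset.sum_comm]
  exact Finset.sum_congr rfl fun u _ => Finset.sum_congr rfl fun w _ => by ring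

lemma SparsePerron.sum_codeg_le (h : SparsePerron k m C G lam x) (v : V) :
    ∑ w, codeg G v w ≤ 2 * C * Fintype.card V := by
  rw [sum_codeg]
  refine le_trans (Finset.sum_le_sum fun u _ => ?_) h.sum_rdeg_le
  exact mul_le_of_le_one_left (rdeg_nonneg G u) (adjInd_le_one G v u)

/-- The two-step walk bound: only the entries in `W` and the bound off `W` matter. -/
lemma SparsePerron.sq_mul_le [DecidableEq V] (h : SparsePerron k m C G lam x) {ε : ℝ} (hε : 0 ≤ ε)
    (W : Finset V) (hW : ∀ w ∉ W, x w ≤ ε) (v : V) :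
    lam ^ 2 * x v ≤ ∑ w ∈ W, codeg G v w * x w + 2 * C * Fintype.card V * ε := by
  rw [h.sq_mul, ← Finset.sum_add_sum_compl W]
  gcongr
  calc ∑ w ∈ Wᶜ, codeg G v w * x w ≤ ∑ w ∈ Wᶜ, codeg G v w * ε := by
        refine Finset.sum_le_sum fun w hw => ?_
        exact mul_le_mul_of_nonneg_left (hW w (by simpa using hw)) (codeg_nonneg G v w)
    _ ≤ ∑ w, codeg G v w * ε := by
        refine Finset.sum_le_sum_of_subset_of_nonneg (Finset.subset_univ _) fun w _ _ => ?_
        exact mul_nonneg (codeg_nonneg G v w) hε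
    _ = (∑ w, codeg G v w) * ε := by rw [Finset.sum_mul]
    _ ≤ _ := mul_le_mul_of_nonneg_right (h.sum_codeg_le v) hε

lemma SparsePerron.lam_mul_le_rdeg (h : SparsePerron k m C G lam x) (v : V) :
    lam * x v ≤ rdeg G v := by
  rw [h.eig]
  exact Finset.sum_le_sum fun u _ => mul_le_of_le_one_right (adjInd_nonneg G v u) (h.le_one u)

/-- A lower bound on degrees in `L` bounds the size of `L`. -/
lemma SparsePerron.card_mul_le (h : SparsePerron k m C G lam x) (L : Finset V) {d : ℝ}
    (hd : ∀ v ∈ L, d ≤ rdeg G v) : L.card * d ≤ 2 * C * Fintype.card V := by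
  calc L.card * d = ∑ v ∈ L, d := by simp
    _ ≤ ∑ v ∈ L, rdeg G v := Finset.sum_le_sum hd
    _ ≤ ∑ v, rdeg G v :=
        Finset.sum_le_sum_of_subset_of_nonneg (Finset.subset_univ _) fun w _ _ => rdeg_nonneg G w
    _ ≤ _ := h.sum_rdeg_le

-- The left side counts adjacent pairs between N(v) and `W`, all of which lie inside N(v) ∪ `W`,
-- where sparsity applies.
open Classical in
lemma SparsePerron.sum_codeg_le_sparse (h : SparsePerron k m C G lam x) (hC : 0 ≤ C)
    (W : Finset V) (v : V) :
    ∑ w ∈ W, codeg G v w ≤ 2 * C * (rdeg G v + W.card) := by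
  set N := Finset.univ.filter fun u => G.Adj v u with hN
  have h1 : rdeg G v = N.card := sum_adjInd_eq_card G Finset.univ v
  rw [sum_codeg]
  calc ∑ u, adjInd G v u * ∑ w ∈ W, adjInd G u w
      = ∑ u ∈ N, ∑ w ∈ W, adjInd G u w := by
        rw [hN, Finset.sum_filter]
        refine Finset.sum_congr rfl fun u _ => ?_
        by_cases huv : G.Adj v u <;> simp [adjInd, huv]
    _ ≤ ∑ u ∈ N ∪ W, ∑ w ∈ N ∪ W, adjInd G u w := by
        refine le_trans (Finset.sum_le_sum fun u _ => ?_)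
          (Finset.sum_le_sum_of_subset_of_nonneg Finset.subset_union_left fun u _ _ => ?_)
        · exact Finset.sum_le_sum_of_subset_of_nonneg Finset.subset_union_right
            fun w _ _ => adjInd_nonneg G u w
        · exact Finset.sum_nonneg fun w _ => adjInd_nonneg G u w
    _ ≤ 2 * C * (N ∪ W).card := h.sparse _
    _ ≤ 2 * C * (N.card + W.card) := by
        gcongr
        exact_mod_cast Finset.card_union_le N W
    _ = _ := by rw [h1]

open Classical in
/-- All but boundedly many vertices have at most `k` neighbours in a bounded set `W`. -/
lemma SparsePerron.sum_codeg_le_common (h : SparsePerron k m C G lam x) (W : Finset V) (v : V) :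
    ∑ w ∈ W, codeg G v w ≤ k * rdeg G v + W.card * (2 ^ W.card * m) := by
  -- `B` is the set of exceptional vertices. Each is a common neighbour of some (k+1)-subset of `W`;
  -- there are at most 2^|W| such subsets, each with fewer than `m` common neighbours.
  set B := Finset.univ.filter fun u => k + 1 ≤ (W.filter fun w => G.Adj u w).card with hB
  have hBcard : B.card ≤ 2 ^ W.card * m := by
    have hsub : B ⊆ (Finset.powersetCard (k + 1) W).biUnion
        fun T => Finset.univ.filter fun u => ∀ t ∈ T, G.Adj t u := by
      intro u hu
      obtain ⟨T, hT, hTc⟩ := Finset.exists_subset_card_eq (Finset.mem_filter.1 hu).2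
      simp only [Finset.mem_biUnion, Finset.mem_powersetCard, Finset.mem_filter,
        Finset.mem_univ, true_and]
      exact ⟨T, ⟨hT.trans (Finset.filter_subset _ _), hTc⟩,
        fun t ht => ((Finset.mem_filter.1 (hT ht)).2).symm⟩
    calc B.card ≤ _ := Finset.card_le_card hsub
      _ ≤ (Finset.powersetCard (k + 1) W).card * m :=
          Finset.card_biUnion_le_card_mul _ _ _ fun T hT =>
            (h.common T _ (Finset.mem_powersetCard.1 hT).2 fun t ht u hu => by
              simp only [Finset.mem_filter] at hu
              exact hu.2 t ht).le
      _ ≤ 2 ^ W.card * m := by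
          gcongr
          rw [← Finset.card_powerset]
          exact Finset.card_le_card fun T hT =>
            Finset.mem_powerset.2 (Finset.mem_powersetCard.1 hT).1
  rw [sum_codeg]
  calc ∑ u, adjInd G v u * ∑ w ∈ W, adjInd G u w
      ≤ ∑ u, (k * adjInd G v u + if u ∈ B then (W.card : ℝ) else 0) := by
        refine Finset.sum_le_sum fun u _ => ?_
        by_cases hu : u ∈ B
        · rw [if_pos hu]
          have h1 := sum_adjInd_le_card G W u
          have h2 : 0 ≤ ∑ w ∈ W, adjInd G u w := Finset.sum_nonneg fun w _ => adjInd_nonneg G u w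
          have h3 := mul_le_of_le_one_left h2 (adjInd_le_one G v u)
          have h4 : 0 ≤ (k : ℝ) * adjInd G v u := mul_nonneg (by positivity) (adjInd_nonneg G v u)
          linarith
        · rw [if_neg hu, add_zero, mul_comm]
          refine mul_le_mul_of_nonneg_right ?_ (adjInd_nonneg G v u)
          rw [sum_adjInd_eq_card]
          have : ¬ k + 1 ≤ (W.filter fun w => G.Adj u w).card := 
            fun hh => hu (Finset.mem_filter.2 ⟨Finset.mem_univ u, hh⟩)
          exact_mod_cast (by omega : (W.filter fun w => G.Adj u w).card ≤ k)
    _ = k * rdeg G v + B.card * W.card := by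
        rw [Finset.sum_add_distrib, ← Finset.mul_sum, Finset.sum_ite_mem]
        simp [rdeg]
    _ ≤ _ := by
        rw [mul_comm (B.card : ℝ)]
        gcongr
        exact_mod_cast hBcard

/-- Vertices of degree close to `n` have many common neighbours. -/
lemma card_le_common_nbrs (G : SimpleGraph V) (T N : Finset V) {δ : ℝ}
    (hN : ∀ u, (∀ t ∈ T, G.Adj t u) → u ∈ N)
    (hT : ∀ t ∈ T, (1 - δ) * Fintype.card V ≤ rdeg G t) :
    (1 - T.card * δ) * Fintype.card V ≤ N.card := by
  classical
  -- Union bound: a vertex outside `N` is missed by at least one vertex of `T`.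
  have key : ∀ u : V, 1 - ∑ t ∈ T, (1 - adjInd G t u) ≤ if u ∈ N then (1 : ℝ) else 0 := by
    intro u
    split_ifs with hu
    · linarith [Finset.sum_nonneg fun t (_ : t ∈ T) => sub_nonneg.2 (adjInd_le_one G t u)]
    · obtain ⟨t, ht, hn⟩ : ∃ t ∈ T, ¬ G.Adj t u := by
        by_contra! hcon
        exact hu (hN u hcon)
      have := Finset.single_le_sum (f := fun t => 1 - adjInd G t u)
        (fun t _ => sub_nonneg.2 (adjInd_le_one G t u)) ht
      simp only [adjInd_of_not_adj hn] at this
      linarith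
  have h1 := Finset.sum_le_sum fun u (_ : u ∈ (Finset.univ : Finset V)) => key u
  rw [Finset.sum_sub_distrib, Finset.sum_comm] at h1
  have h2 : ∑ t ∈ T, ∑ u : V, (1 - adjInd G t u) ≤ T.card * (δ * Fintype.card V) := by
    rw [← nsmul_eq_mul, ← Finset.sum_const]
    refine Finset.sum_le_sum fun t ht => ?_
    have := hT t ht
    simp only [Finset.sum_sub_distrib, Finset.sum_const, Finset.card_univ, nsmul_eq_mul, mul_one]
    change (Fintype.card V : ℝ) - rdeg G t ≤ _
    linarith
  simp only [Finset.sum_const, Finset.card_univ, nsmul_eq_mul, mul_one, Finset.sum_ite_mem,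
    Finset.univ_inter] at h1
  linarith

end Counting

/-! ### The large entries of the eigenvector -/

section Asymptotic

variable {k m : ℕ} {C : ℝ}

lemma SparsePerron.lam_sq_ge {n : ℕ} {G : SimpleGraph (Fin n)} {lam : ℝ} {x : Fin n → ℝ}
    (h : SparsePerron k m C G lam x) : (k : ℝ) * (n - k) ≤ lam ^ 2 := by
  simpa using h.lam_sq

lemma eventually_le_lam (hk : 1 ≤ k) (m : ℕ) (C K : ℝ) :
    ∀ᶠ n in atTop, ∀ (G : SimpleGraph (Fin n)) lam x, SparsePerron k m C G lam x → K ≤ lam := by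
  filter_upwards [eventually_ge_atTop ⌈(k : ℝ) + K ^ 2⌉₊] with n hn G lam x h
  have hn' : (k : ℝ) + K ^ 2 ≤ n := (Nat.le_ceil _).trans (by exact_mod_cast hn)
  have hk' : (1 : ℝ) ≤ k := by exact_mod_cast hk
  have h1 := h.lam_sq_ge
  have h0 := h.lam_nonneg
  by_contra! hlt
  nlinarith [sq_nonneg K]

/-- Bootstrapping. As λ → ∞ and deg(v) ≥ λ x_v, the set `W` of entries at least ε is a small
fraction of all vertices. Sparsity on N(v) ∪ `W` then forces linear degree at each entry at least α,
and only boundedly many vertices have linear degree. -/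
lemma exists_card_large_le (hk : 1 ≤ k) (m : ℕ) (hC : 1 ≤ C) {α : ℝ} (hα : 0 < α) :
    ∃ M : ℕ, ∀ᶠ n in atTop, ∀ (G : SimpleGraph (Fin n)) lam x, SparsePerron k m C G lam x →
      ∀ L : Finset (Fin n), (∀ v ∈ L, α ≤ x v) → L.card ≤ M := by
  refine ⟨⌈16 * C ^ 2 / α⌉₊, ?_⟩
  filter_upwards [eventually_le_lam hk m C (512 * C ^ 3 / α ^ 2), eventually_ge_atTop (2 * k),
    eventually_gt_atTop 0] with n hlam hn hn0 G lam x h L hL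
  have hn' : 2 * (k : ℝ) ≤ n := by exact_mod_cast hn
  have hn0' : (0 : ℝ) < n := by exact_mod_cast hn0
  have hk' : (1 : ℝ) ≤ k := by exact_mod_cast hk
  have hC0 : 0 < C := by linarith
  -- With this ε the small entries contribute at most αn/8, and |W| ≤ αn/(16C) costs another αn/8,
  -- out of the αn/2 available below λ² x_v.
  set ε := α / (16 * C) with hε
  have hε0 : 0 < ε := by positivity
  have hCε : C * ε = α / 16 := by rw [hε]; field_simp
  set W := Finset.univ.filter fun v => ε ≤ x v with hW
  have hWcard : (W.card : ℝ) * (16 * C) ≤ α * n := by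
    have h1 : (W.card : ℝ) * (32 * C ^ 2 / α) ≤ 2 * C * n := by
      have := h.card_mul_le W (d := 32 * C ^ 2 / α) fun v hv => by
        calc 32 * C ^ 2 / α = 512 * C ^ 3 / α ^ 2 * ε := by rw [hε]; field_simp; norm_num
          _ ≤ lam * x v :=
            mul_le_mul (hlam G lam x h) (Finset.mem_filter.1 hv).2 hε0.le h.lam_nonneg
          _ ≤ _ := h.lam_mul_le_rdeg v
      simpa using this
    have h2 : (W.card : ℝ) * (32 * C ^ 2 / α) * α = W.card * (16 * C) * (2 * C) := by
      field_simp; ring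
    have h3 := mul_le_mul_of_nonneg_right h1 hα.le
    rw [h2] at h3
    nlinarith
  have hdeg : ∀ v ∈ L, α * n / (8 * C) ≤ rdeg G v := by
    intro v hv
    have h1 := h.sq_mul_le hε0.le W (fun w hw => by
      have : ¬ ε ≤ x w := by simpa [hW] using hw
      linarith) v
    have h2 : ∑ w ∈ W, codeg G v w * x w ≤ ∑ w ∈ W, codeg G v w :=
      Finset.sum_le_sum fun w _ => mul_le_of_le_one_right (codeg_nonneg G v w) (h.le_one w)
    have h3 := h.sum_codeg_le_sparse hC0.le W v
    have h4 : (n / 2 : ℝ) * α ≤ lam ^ 2 * x v := by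
      refine mul_le_mul ?_ (hL v hv) hα.le (sq_nonneg _)
      refine le_trans ?_ h.lam_sq_ge
      nlinarith
    simp only [Fintype.card_fin] at h1
    have h5 : 2 * C * n * ε = α / 8 * n := by linear_combination 2 * (n : ℝ) * hCε
    rw [div_le_iff₀ (by positivity)]
    nlinarith
  have h1 := h.card_mul_le L hdeg
  simp only [Fintype.card_fin] at h1
  have h2 : (L.card : ℝ) ≤ 16 * C ^ 2 / α := by
    rw [le_div_iff₀ hα]
    have h3 : (L.card : ℝ) * (α * n / (8 * C)) * (8 * C) = L.card * α * n := by field_simp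
    have h4 := mul_le_mul_of_nonneg_right h1 (by positivity : 0 ≤ 8 * C)
    rw [h3] at h4
    have h5 : (L.card : ℝ) * α * n ≤ 16 * C ^ 2 * n := by linarith
    exact le_of_mul_le_mul_right h5 hn0'
  exact_mod_cast h2.trans (Nat.le_ceil _)

/-- Beyond a bounded error, the codegrees into `{x ≥ ε}` sum to at most `k` times the degree. -/
lemma exists_sum_codeg_large_le (hk : 1 ≤ k) (m : ℕ) (hC : 1 ≤ C) {ε : ℝ} (hε : 0 < ε) :
    ∃ D : ℝ, 0 ≤ D ∧ ∀ᶠ n in atTop, ∀ (G : SimpleGraph (Fin n)) lam x,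
      SparsePerron k m C G lam x → ∀ v, ∀ W : Finset (Fin n), (∀ w ∈ W, ε ≤ x w) →
        ∑ w ∈ W, codeg G v w ≤ k * rdeg G v + D := by
  obtain ⟨M, hM⟩ := exists_card_large_le hk m hC hε
  refine ⟨M * (2 ^ M * m), by positivity, ?_⟩
  filter_upwards [hM] with n hM G lam x h v W hW
  refine (h.sum_codeg_le_common W v).trans ?_
  have := hM G lam x h W hW
  gcongr
  norm_num

/-- Compare k(n-k) x_v with the two-step bound k deg(v) + D + 2Cεn and divide by k. -/
lemma eventually_le_rdeg (hk : 1 ≤ k) (m : ℕ) (hC : 1 ≤ C) {δ : ℝ} (hδ : 0 < δ) :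
    ∀ᶠ n in atTop, ∀ (G : SimpleGraph (Fin n)) lam x, SparsePerron k m C G lam x →
      ∀ v, (x v - δ) * n ≤ rdeg G v := by
  have hC0 : 0 < C := by linarith
  set ε := δ / (4 * C) with hε
  have hε0 : 0 < ε := by positivity
  have hCε : C * ε = δ / 4 := by rw [hε]; field_simp
  obtain ⟨D, hD0, hD⟩ := exists_sum_codeg_large_le hk m hC hε0
  filter_upwards [hD, eventually_ge_atTop ⌈2 * ((k : ℝ) ^ 2 + D) / δ⌉₊] with n hD hn G lam x h v
  have hn' : 2 * ((k : ℝ) ^ 2 + D) / δ ≤ n := (Nat.le_ceil _).trans (by exact_mod_cast hn)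
  rw [div_le_iff₀ hδ] at hn'
  have hk' : (1 : ℝ) ≤ k := by exact_mod_cast hk
  have hn0 : (0 : ℝ) ≤ n := by positivity
  set W := Finset.univ.filter fun v => ε ≤ x v with hW
  have h1 := h.sq_mul_le hε0.le W (fun w hw => by
    have : ¬ ε ≤ x w := by simpa [hW] using hw
    linarith) v
  have h2 : ∑ w ∈ W, codeg G v w * x w ≤ ∑ w ∈ W, codeg G v w :=
    Finset.sum_le_sum fun w _ => mul_le_of_le_one_right (codeg_nonneg G v w) (h.le_one w)
  have h3 := hD G lam x h v W fun w hw => (Finset.mem_filter.1 hw).2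
  have h4 := mul_le_mul_of_nonneg_right h.lam_sq_ge (h.nonneg v)
  simp only [Fintype.card_fin] at h1
  have h5 : 2 * C * n * ε = δ / 2 * n := by linear_combination 2 * (n : ℝ) * hCε
  have h6 : (k : ℝ) * k * x v ≤ k ^ 2 := by
    rw [pow_two]; exact mul_le_of_le_one_right (by positivity) (h.le_one v)
  have h7 : (k : ℝ) * ((x v - δ) * n) ≤ k * rdeg G v := by
    have : δ * n ≤ k * (δ * n) := le_mul_of_one_le_left (by positivity) hk'
    nlinarith
  exact le_of_mul_le_mul_left h7 (by linarith)

/-- An entry which is not small is close to `1`. -/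
lemma eventually_near_one (hk : 1 ≤ k) (m : ℕ) (hC : 1 ≤ C) {α δ : ℝ} (hα : 0 < α)
    (hδ : 0 < δ) (hδ1 : δ ≤ 1) :
    ∀ᶠ n in atTop, ∀ (G : SimpleGraph (Fin n)) lam x, SparsePerron k m C G lam x →
      ∀ w, α ≤ x w → 1 - δ ≤ x w := by
  have hC0 : 0 < C := by linarith
  set δ₁ := α * δ / 8 with hδ₁
  have hδ₁0 : 0 < δ₁ := by positivity
  set ε := min α (δ₁ / (4 * C)) with hε
  have hε0 : 0 < ε := lt_min hα (by positivity)
  have hCε : C * ε ≤ δ₁ / 4 := by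
    calc C * ε ≤ C * (δ₁ / (4 * C)) := mul_le_mul_of_nonneg_left (min_le_right _ _) hC0.le
      _ = δ₁ / 4 := by field_simp
  obtain ⟨D, hD0, hD⟩ := exists_sum_codeg_large_le hk m hC hε0
  filter_upwards [hD, eventually_le_rdeg hk m hC hδ₁0,
    eventually_ge_atTop ⌈2 * ((k : ℝ) ^ 2 + D) / δ₁⌉₊, eventually_gt_atTop 0]
    with n hD hdeg hn hnpos G lam x h w hw
  have hn' : 2 * ((k : ℝ) ^ 2 + D) / δ₁ ≤ n := (Nat.le_ceil _).trans (by exact_mod_cast hn)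
  rw [div_le_iff₀ hδ₁0] at hn'
  have hk' : (1 : ℝ) ≤ k := by exact_mod_cast hk
  have hn0 : (0 : ℝ) < n := by exact_mod_cast hnpos
  obtain ⟨z, hz⟩ := h.exists_one
  set W := Finset.univ.filter fun v => ε ≤ x v with hW
  have h1 := h.sq_mul_le hε0.le W (fun w hw => by
    have : ¬ ε ≤ x w := by simpa [hW] using hw
    linarith) z
  rw [hz, mul_one] at h1
  simp only [Fintype.card_fin] at h1
  have h3 := hD G lam x h z W fun w hw => (Finset.mem_filter.1 hw).2
  have h4 : rdeg G z ≤ n := by simpa using rdeg_le_card G z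
  -- The codegrees from `z` into `W` sum to at most kn + D, but weighted by `x` they must still
  -- reach nearly k(n-k): the total deficit is at most δ₁n.
  have h5 : ∑ w ∈ W, codeg G z w * (1 - x w) ≤ δ₁ * n := by
    simp only [mul_sub, mul_one, Finset.sum_sub_distrib]
    have := h.lam_sq_ge
    nlinarith
  have h6 : codeg G z w * (1 - x w) ≤ δ₁ * n := by
    refine le_trans (Finset.single_le_sum (f := fun w => codeg G z w * (1 - x w))
      (fun v _ => mul_nonneg (codeg_nonneg G z v) (sub_nonneg.2 (h.le_one v))) ?_) h5
    exact Finset.mem_filter.2 ⟨Finset.mem_univ w, (min_le_left _ _).trans hw⟩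
  have h7 := rdeg_add_rdeg_le G z w
  have h8 := hdeg G lam x h z
  have h9 := hdeg G lam x h w
  simp only [Fintype.card_fin] at h7
  rw [hz] at h8
  -- The degrees of `z` and `w` are at least (1 - δ₁)n and (x_w - δ₁)n, so they overlap in (x_w -
  -- 2δ₁)n vertices.
  have h10 : α / 2 * n ≤ codeg G z w := by
    have : α * δ ≤ α := mul_le_of_le_one_right hα.le hδ1
    have h11 : α / 2 * n ≤ (x w - 2 * δ₁) * n :=
      mul_le_mul_of_nonneg_right (by linarith) hn0.le
    linarith
  have h11 : α / 2 * n * (1 - x w) ≤ α / 2 * n * (δ / 4) := by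
    calc _ ≤ codeg G z w * (1 - x w) :=
          mul_le_mul_of_nonneg_right h10 (sub_nonneg.2 (h.le_one w))
      _ ≤ δ₁ * n := h6
      _ = _ := by rw [hδ₁]; ring
  have := le_of_mul_le_mul_left h11 (by positivity)
  linarith

/-- There are exactly `k` large entries, all close to `1`, at vertices of degree close to `n`. -/
lemma eventually_large_entries (hk : 1 ≤ k) (m : ℕ) (hC : 1 ≤ C) {α δ : ℝ} (hα : 0 < α)
    (hCα : 8 * C * α ≤ 1) (hδ : 0 < δ) (hδk : δ * (k + 1) ≤ 1 / 2) :
    ∀ᶠ n in atTop, ∀ (G : SimpleGraph (Fin n)) lam x, SparsePerron k m C G lam x →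
      ∀ L : Finset (Fin n), (∀ v, v ∈ L ↔ α ≤ x v) →
        L.card = k ∧ ∀ v ∈ L, 1 - δ ≤ x v ∧ (1 - δ) * n ≤ rdeg G v := by
  have hk' : (1 : ℝ) ≤ k := by exact_mod_cast hk
  have hδ1 : δ / 2 ≤ 1 := by nlinarith
  filter_upwards [eventually_near_one hk m hC hα (half_pos hδ) hδ1,
    eventually_le_rdeg hk m hC (half_pos hδ), eventually_ge_atTop (2 * m),
    eventually_gt_atTop (2 * k ^ 2)] with n hone hdeg hnm hnk G lam x h L hL
  have hnk' : 2 * (k : ℝ) ^ 2 < n := by exact_mod_cast hnk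
  have hn0 : (0 : ℝ) ≤ n := by positivity
  have hL2 : ∀ v ∈ L, 1 - δ ≤ x v ∧ (1 - δ) * n ≤ rdeg G v := by
    intro v hv
    have h1 := hone G lam x h v ((hL v).1 hv)
    refine ⟨by linarith, le_trans ?_ (hdeg G lam x h v)⟩
    exact mul_le_mul_of_nonneg_right (by linarith) hn0
  refine ⟨le_antisymm ?_ ?_, hL2⟩
  -- Were there k+1 large entries, their vertices would have at least (1 - (k+1)δ)n ≥ n/2 ≥ m common
  -- neighbours.
  · by_contra! hlt
    obtain ⟨T, hT, hTc⟩ := Finset.exists_subset_card_eq (Nat.succ_le_of_lt hlt)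
    classical
    set N : Finset (Fin n) := Finset.univ.filter fun u => ∀ t ∈ T, G.Adj t u with hN
    have h1 := card_le_common_nbrs G T N (δ := δ) (fun u hu => by simpa [hN] using hu)
      fun t ht => by simpa using (hL2 t (hT ht)).2
    have h2 := (Nat.cast_lt (α := ℝ)).2 (h.common T N hTc fun t ht u hu => by
      simp only [hN, Finset.mem_filter] at hu
      exact hu.2 t ht)
    rw [hTc] at h1
    push_cast at h1
    simp only [Fintype.card_fin] at h1
    have h3 : (2 * m : ℝ) ≤ n := by exact_mod_cast hnm
    nlinarith
  -- With at most k-1 large entries, λ² ≤ (k-1)n + 2Cαn ≤ (k - 3/4)n, which is below k(n-k) once n >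
  -- 2k².
  · by_contra! hlt
    obtain ⟨z, hz⟩ := h.exists_one
    have h1 := h.sq_mul_le hα.le L (fun w hw => by
      have : ¬ α ≤ x w := fun hh => hw ((hL w).2 hh)
      linarith) z
    rw [hz, mul_one] at h1
    have h2 : ∑ w ∈ L, codeg G z w * x w ≤ L.card * n := by
      rw [← nsmul_eq_mul]
      refine Finset.sum_le_card_nsmul _ _ _ fun w _ => ?_
      refine (mul_le_of_le_one_right (codeg_nonneg G z w) (h.le_one w)).trans ?_
      simpa using codeg_le_card G z w
    have h3 : (L.card : ℝ) + 1 ≤ k := by exact_mod_cast hlt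
    have h4 := h.lam_sq_ge
    simp only [Fintype.card_fin] at h1
    nlinarith

end Asymptotic

/-! ### The Rayleigh quotient of the adjacency matrix -/

section Rayleigh

open Matrix

variable {n : ℕ} (G : SimpleGraph (Fin n))

open Classical in
lemma mulVec_adjMatrix_apply (y : Fin n → ℝ) (v : Fin n) :
    (G.adjMatrix ℝ *ᵥ y) v = ∑ u, adjInd G v u * y u := by
  simp only [mulVec, dotProduct, adjMatrix_apply, adjInd]

open Classical in
/-- The matrix `λ(G) I - A(G)`. -/
noncomputable def lambdaSub : Matrix (Fin n) (Fin n) ℝ :=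
  lambdaOne G • (1 : Matrix (Fin n) (Fin n) ℝ) - G.adjMatrix ℝ

open Classical in
lemma isHermitian_adjMatrix_real : (G.adjMatrix ℝ).IsHermitian := by
  rw [Matrix.IsHermitian, conjTranspose_eq_transpose_of_trivial, transpose_adjMatrix]

lemma posSemidef_lambdaSub : (lambdaSub G).PosSemidef := by
  classical
  have hB : (lambdaSub G).IsHermitian := by
    refine IsHermitian.sub ?_ (isHermitian_adjMatrix_real G)
    rw [Matrix.IsHermitian, conjTranspose_smul, conjTranspose_one, star_trivial]
  rw [Matrix.posSemidef_iff_isHermitian_and_spectrum_nonneg]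
  refine ⟨hB, fun t ht => ?_⟩
  -- A spectral value t of λI - A corresponds to λ - t in the spectrum of A, which cannot exceed λ;
  -- hence t ≥ 0.
  have h1 : lambdaOne G - t ∈ spectrum ℝ (G.adjMatrix ℝ) := by
    rw [spectrum.mem_iff, Algebra.algebraMap_eq_smul_one] at ht ⊢
    rw [← IsUnit.neg_iff] at ht
    convert ht using 2
    rw [lambdaSub, sub_smul]; abel
  have h2 : lambdaOne G - t ≤ lambdaOne G := by
    unfold lambdaOne at h1 ⊢
    convert le_csSup (Matrix.finite_real_spectrum).bddAbove h1
  simpa using h2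

lemma lambdaSub_mulVec_apply (y : Fin n → ℝ) (v : Fin n) :
    (lambdaSub G *ᵥ y) v = lambdaOne G * y v - ∑ u, adjInd G v u * y u := by
  rw [lambdaSub, sub_mulVec, Pi.sub_apply, smul_mulVec, one_mulVec, mulVec_adjMatrix_apply]
  simp

lemma dotProduct_lambdaSub (y : Fin n → ℝ) :
    star y ⬝ᵥ (lambdaSub G *ᵥ y) =
      lambdaOne G * ∑ u, y u ^ 2 - ∑ u, ∑ v, adjInd G u v * (y u * y v) := by
  simp only [dotProduct, Finset.mul_sum, ← Finset.sum_sub_distrib, star_trivial]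
  refine Finset.sum_congr rfl fun u _ => ?_
  rw [lambdaSub_mulVec_apply, mul_sub, Finset.mul_sum]
  congr 1
  · ring
  · exact Finset.sum_congr rfl fun v _ => by ring

lemma rayleigh_le (y : Fin n → ℝ) :
    ∑ u, ∑ v, adjInd G u v * (y u * y v) ≤ lambdaOne G * ∑ u, y u ^ 2 := by
  have := (posSemidef_lambdaSub G).re_dotProduct_nonneg y
  rw [dotProduct_lambdaSub] at this
  simpa using this

/-- A vector attaining the maximal Rayleigh quotient is an eigenvector. -/
lemma eig_of_rayleigh_eq {y : Fin n → ℝ}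
    (h : lambdaOne G * ∑ u, y u ^ 2 ≤ ∑ u, ∑ v, adjInd G u v * (y u * y v)) (v : Fin n) :
    lambdaOne G * y v = ∑ u, adjInd G v u * y u := by
  have h1 : star y ⬝ᵥ (lambdaSub G *ᵥ y) = 0 := by
    rw [dotProduct_lambdaSub]
    linarith [rayleigh_le G y]
  rw [(posSemidef_lambdaSub G).dotProduct_mulVec_zero_iff] at h1
  have h2 := congrFun h1 v
  rw [lambdaSub_mulVec_apply] at h2
  simpa [sub_eq_zero] using h2

lemma exists_eig (hn : 0 < n) :
    ∃ y : Fin n → ℝ, y ≠ 0 ∧ ∀ v, lambdaOne G * y v = ∑ u, adjInd G v u * y u := by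
  classical
  have : Nonempty (Fin n) := ⟨⟨0, hn⟩⟩
  have hmem : lambdaOne G ∈ spectrum ℝ (G.adjMatrix ℝ) := by
    unfold lambdaOne
    convert Set.Nonempty.csSup_mem ?_ (Matrix.finite_real_spectrum (A := G.adjMatrix ℝ))
    rw [(isHermitian_adjMatrix_real G).spectrum_real_eq_range_eigenvalues]
    exact Set.range_nonempty _
  have hdet : (lambdaSub G).det = 0 := by
    rw [spectrum.mem_iff, Algebra.algebraMap_eq_smul_one, Matrix.isUnit_iff_isUnit_det,
      isUnit_iff_ne_zero, not_not] at hmem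
    exact hmem
  obtain ⟨y, hy, h0⟩ := Matrix.exists_mulVec_eq_zero_iff.2 hdet
  refine ⟨y, hy, fun v => ?_⟩
  have h2 := congrFun h0 v
  rw [lambdaSub_mulVec_apply] at h2
  simpa [sub_eq_zero] using h2

lemma isPerronVector_iff (x : Fin n → ℝ) : IsPerronVector G x ↔
    (∀ v, lambdaOne G * x v = ∑ u, adjInd G v u * x u) ∧
      (∀ v, 0 ≤ x v) ∧ (∀ v, x v ≤ 1) ∧ ∃ z, x z = 1 := by
  unfold IsPerronVector
  refine and_congr_left fun _ => ?_
  rw [funext_iff]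
  refine forall_congr' fun v => ?_
  rw [mulVec_adjMatrix_apply, eq_comm]
  simp

/-- Taking absolute values of an eigenvector does not lower the quadratic form, so |y| still attains
the maximal Rayleigh quotient and is an eigenvector too. -/
lemma exists_isPerronVector (hn : 0 < n) : ∃ x, IsPerronVector G x := by
  have : Nonempty (Fin n) := ⟨⟨0, hn⟩⟩
  obtain ⟨y, hy0, hy⟩ := exists_eig G hn
  have habs : ∀ v, lambdaOne G * |y v| = ∑ u, adjInd G v u * |y u| := by
    refine eig_of_rayleigh_eq G ?_
    simp only [sq_abs, Finset.mul_sum]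
    refine Finset.sum_le_sum fun u _ => ?_
    calc lambdaOne G * y u ^ 2 = ∑ v, adjInd G u v * (y u * y v) := by
          rw [pow_two, mul_left_comm, hy u, Finset.mul_sum]
          exact Finset.sum_congr rfl fun v _ => by ring
      _ ≤ _ := Finset.sum_le_sum fun v _ =>
          mul_le_mul_of_nonneg_left ((le_abs_self _).trans (abs_mul _ _).le) (adjInd_nonneg G u v)
  obtain ⟨z, hz⟩ := Finite.exists_max fun v => |y v|
  have hz0 : 0 < |y z| := by
    obtain ⟨v, hv⟩ := Function.ne_iff.1 hy0
    exact (abs_pos.2 hv).trans_le (hz v)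
  refine ⟨fun v => |y v| / |y z|, (isPerronVector_iff G _).2 ⟨fun v => ?_, fun v => by positivity,
    fun v => (div_le_one hz0).2 (hz v), z, div_self hz0.ne'⟩⟩
  rw [← mul_div_assoc, habs, Finset.sum_div]
  exact Finset.sum_congr rfl fun u _ => by ring

/-- A graph on `n` vertices containing `K_{k,n-k}` has `λ ≥ √(k(n-k))`. -/
lemma sqrt_le_lambdaOne {k : ℕ} (hkn : k < n) (hk : 1 ≤ k)
    (h : completeBipartiteGraph (Fin k) (Fin (n - k)) ⊑ G) :
    √((k : ℝ) * (n - k)) ≤ lambdaOne G := by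
  obtain ⟨f⟩ := h
  have hcard : Fintype.card (Fin k ⊕ Fin (n - k)) = Fintype.card (Fin n) := by simp; omega
  have hbij : Function.Bijective f :=
    (Fintype.bijective_iff_injective_and_card _).2 ⟨f.injective, hcard⟩
  set e := Equiv.ofBijective f hbij with he
  have hr : ((n - k : ℕ) : ℝ) = n - k := by rw [Nat.cast_sub hkn.le]
  set r : ℝ := n - k with hrdef
  have hr0 : 0 < r := by rw [← hr]; exact_mod_cast Nat.sub_pos_of_lt hkn
  have hk0 : (0 : ℝ) < k := by exact_mod_cast hk
  -- The Perron vector of K_{k,n-k} up to scaling: both parts have the same total weight k(n-k).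
  set y : Fin k ⊕ Fin (n - k) → ℝ := Sum.elim (fun _ => √r) (fun _ => √k) with hy
  have h1 := rayleigh_le G (y ∘ e.symm)
  have h2 : ∑ u, (y ∘ e.symm) u ^ 2 = 2 * (k * r) := by
    rw [← Equiv.sum_comp e]
    simp only [Function.comp, Equiv.symm_apply_apply, Fintype.sum_sum_type, hy, Sum.elim_inl,
      Sum.elim_inr, Real.sq_sqrt hr0.le, Real.sq_sqrt hk0.le, Finset.sum_const, Finset.card_univ,
      Fintype.card_fin, nsmul_eq_mul, hr]
    ring
  have hy0 : ∀ i, 0 ≤ y i := by rintro (i | i) <;> simp [hy]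
  have hadj : ∀ i j, 1 ≤ adjInd G (e (Sum.inl i)) (e (Sum.inr j)) := by
    intro i j
    rw [adjInd_of_adj]
    exact f.toHom.map_adj (by simp)
  have h3 : 2 * (k * r) * (√k * √r) ≤
      ∑ u, ∑ v, adjInd G u v * ((y ∘ e.symm) u * (y ∘ e.symm) v) := by
    rw [← Equiv.sum_comp e]
    simp_rw [← Equiv.sum_comp e (fun v => adjInd G _ v * _)]
    simp only [Function.comp, Equiv.symm_apply_apply, Fintype.sum_sum_type]
    have hLR : ((k * r) * (√k * √r) : ℝ) ≤
        ∑ i, ∑ j, adjInd G (e (Sum.inl i)) (e (Sum.inr j)) * (y (Sum.inl i) * y (Sum.inr j)) := by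
      calc ((k * r) * (√k * √r) : ℝ) = ∑ i : Fin k, ∑ j : Fin (n - k), (√r * √k) := by
            simp [hr]; ring
        _ ≤ _ := Finset.sum_le_sum fun i _ => Finset.sum_le_sum fun j _ => by
            simpa [hy] using le_mul_of_one_le_left (by positivity) (hadj i j)
    have hRL : ((k * r) * (√k * √r) : ℝ) ≤
        ∑ j, ∑ i, adjInd G (e (Sum.inr j)) (e (Sum.inl i)) * (y (Sum.inr j) * y (Sum.inl i)) := by
      refine hLR.trans (le_of_eq ?_)
      rw [Finset.sum_comm]
      exact Finset.sum_congr rfl fun i _ => Finset.sum_congr rfl fun j _ => by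
        rw [adjInd_comm, mul_comm (y _)]
    have hpos : ∀ i j, 0 ≤ adjInd G (e i) (e j) * (y i * y j) := fun i j =>
      mul_nonneg (adjInd_nonneg G _ _) (mul_nonneg (hy0 i) (hy0 j))
    have hLL : 0 ≤ ∑ i, ∑ j, adjInd G (e (Sum.inl i)) (e (Sum.inl j)) *
        (y (Sum.inl i) * y (Sum.inl j)) :=
      Finset.sum_nonneg fun i _ => Finset.sum_nonneg fun j _ => hpos _ _
    have hRR : 0 ≤ ∑ i, ∑ j, adjInd G (e (Sum.inr i)) (e (Sum.inr j)) *
        (y (Sum.inr i) * y (Sum.inr j)) :=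
      Finset.sum_nonneg fun i _ => Finset.sum_nonneg fun j _ => hpos _ _
    simp only [Finset.sum_add_distrib]
    linarith
  rw [h2] at h1
  rw [Real.sqrt_mul hk0.le]
  have h4 := h3.trans h1
  rw [mul_comm (lambdaOne G)] at h4
  exact le_of_mul_le_mul_left h4 (by positivity)

end Rayleigh

/-! ### Joining all vertices to the large ones increases `λ` -/

/-- In a sparse graph, the weighted number of edges inside a set of small vertices is small. -/
lemma sum_adjInd_mul_le {V : Type*} [DecidableEq V] {G : SimpleGraph V} {C β : ℝ} {x : V → ℝ}
    (hsp : ∀ S : Finset V, ∑ u ∈ S, ∑ v ∈ S, adjInd G u v ≤ 2 * C * S.card) (hx : ∀ v, 0 ≤ x v)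
    (S : Finset V) (hβ : ∀ v ∈ S, x v ≤ β) :
    ∑ u ∈ S, ∑ v ∈ S, adjInd G u v * (x u * x v) ≤ 4 * C * β * ∑ u ∈ S, x u := by
  induction hs : S.card generalizing S with
  | zero => simp [Finset.card_eq_zero.1 hs]
  | succ s ih =>
    have hne : S.Nonempty := Finset.card_pos.1 (by omega)
    -- Sparsity gives a vertex of degree at most 2C inside `S`. Removing such vertices one by one
    -- charges each edge to the endpoint removed first, which makes the bound linear in Σ x.
    obtain ⟨w, hw, hwd⟩ : ∃ w ∈ S, ∑ v ∈ S, adjInd G w v ≤ 2 * C := by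
      refine Finset.exists_le_of_sum_le hne ((hsp S).trans (le_of_eq ?_))
      simp [mul_comm]
    have ih' := ih (S.erase w) (fun v hv => hβ v (Finset.mem_of_mem_erase hv))
      (by rw [Finset.card_erase_of_mem hw, hs]; rfl)
    have hβ0 : 0 ≤ β := (hx w).trans (hβ w hw)
    have hrow : ∑ v ∈ S.erase w, adjInd G w v * (x w * x v) ≤ 2 * C * β * x w := by
      calc ∑ v ∈ S.erase w, adjInd G w v * (x w * x v)
          ≤ ∑ v ∈ S, adjInd G w v * (x w * x v) :=
            Finset.sum_le_sum_of_subset_of_nonneg (Finset.erase_subset _ _) fun v _ _ =>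
              mul_nonneg (adjInd_nonneg G _ _) (mul_nonneg (hx w) (hx v))
        _ ≤ ∑ v ∈ S, adjInd G w v * (x w * β) := Finset.sum_le_sum fun v hv =>
            mul_le_mul_of_nonneg_left (mul_le_mul_of_nonneg_left (hβ v hv) (hx w))
              (adjInd_nonneg G _ _)
        _ = (∑ v ∈ S, adjInd G w v) * (x w * β) := by rw [Finset.sum_mul]
        _ ≤ 2 * C * (x w * β) := mul_le_mul_of_nonneg_right hwd (mul_nonneg (hx w) hβ0)
        _ = _ := by ring
    have hcol : ∑ u ∈ S.erase w, adjInd G u w * (x u * x w) ≤ 2 * C * β * x w := by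
      refine le_trans (le_of_eq ?_) hrow
      exact Finset.sum_congr rfl fun v _ => by rw [adjInd_comm, mul_comm (x v)]
    have hsplit : ∀ g : V → ℝ, ∑ u ∈ S, g u = g w + ∑ u ∈ S.erase w, g u := fun g =>
      (Finset.add_sum_erase S g hw).symm
    simp_rw [hsplit, Finset.sum_add_distrib, adjInd_self, zero_mul, zero_add]
    rw [mul_add]
    linarith

/-- If a graph `G'` with `λ(G') ≤ λ(G)` has all edges between `L` and the rest, and is not worse
than `G` inside `L` and inside the common neighbourhood `R` of `L`, then `G` has all edges
between `L` and the rest, too. -/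
lemma full_of_comparison {n : ℕ} {G G' : SimpleGraph (Fin n)} {x : Fin n → ℝ} {C β m : ℝ}
    (hle : lambdaOne G' ≤ lambdaOne G)
    (heig : ∀ v, lambdaOne G * x v = ∑ u, adjInd G v u * x u) (hx : ∀ v, 0 ≤ x v)
    (hsp : ∀ S : Finset (Fin n), ∑ u ∈ S, ∑ v ∈ S, adjInd G u v ≤ 2 * C * S.card)
    (L R : Finset (Fin n)) (hL : ∀ v ∈ L, 1 / 2 ≤ x v)
    (hβ : ∀ v ∉ L, x v ≤ β)
    (hR : ∀ v, v ∈ R ↔ v ∉ L ∧ ∀ u ∈ L, G.Adj u v)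
    (hm : ∀ v ∉ L, ∑ u ∈ R, adjInd G v u ≤ m)
    (hG' : ∀ u ∈ L, ∀ v ∉ L, G'.Adj u v)
    (hsum : 0 ≤ ∑ u ∈ L, ∑ v ∈ L, (adjInd G' u v - adjInd G u v) * (x u * x v) +
      ∑ u ∈ R, ∑ v ∈ R, (adjInd G' u v - adjInd G u v) * (x u * x v))
    (hsmall : 2 * m * β + 4 * C * β ≤ 1 / 2) :
    ∀ u ∈ L, ∀ v ∉ L, G.Adj u v := by
  set E : Finset (Fin n) := (L ∪ R)ᶜ with hE
  have hmemE : ∀ v, v ∈ E ↔ v ∉ L ∧ v ∉ R := fun v => by simp [hE]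
  have hdLR : Disjoint L R := by
    rw [Finset.disjoint_right]; exact fun v hv => ((hR v).1 hv).1
  have hsplit : ∀ g : Fin n → ℝ, ∑ u, g u = ∑ u ∈ L, g u + ∑ u ∈ R, g u + ∑ u ∈ E, g u := by
    intro g
    rw [← Finset.sum_union hdLR, hE, Finset.sum_add_sum_compl]
  set f : Fin n → Fin n → ℝ := fun u v => (adjInd G' u v - adjInd G u v) * (x u * x v) with hf
  have hfsymm : ∀ u v, f u v = f v u := fun u v => by
    simp only [hf]; rw [adjInd_comm G' u v, adjInd_comm G u v, mul_comm (x u)]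
  have hfge : ∀ u v, -(adjInd G u v * (x u * x v)) ≤ f u v := by
    intro u v
    have := mul_nonneg (adjInd_nonneg G' u v) (mul_nonneg (hx u) (hx v))
    simp only [hf]; linarith
  have hLR : ∑ u ∈ L, ∑ v ∈ R, f u v = 0 := by
    refine Finset.sum_eq_zero fun u hu => Finset.sum_eq_zero fun v hv => ?_
    have hv' := (hR v).1 hv
    simp only [hf]
    rw [adjInd_of_adj (hG' u hu v hv'.1), adjInd_of_adj (hv'.2 u hu)]
    ring
  -- Every vertex of `E` misses some vertex of `L` in `G`; the new edge has weight at least x_v / 2.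
  have hLE : (∑ v ∈ E, x v) / 2 ≤ ∑ u ∈ L, ∑ v ∈ E, f u v := by
    rw [Finset.sum_comm, Finset.sum_div]
    refine Finset.sum_le_sum fun v hv => ?_
    have hv' := (hmemE v).1 hv
    obtain ⟨w, hw, hwv⟩ : ∃ w ∈ L, ¬ G.Adj w v := by
      by_contra! hcon
      exact hv'.2 ((hR v).2 ⟨hv'.1, hcon⟩)
    have hnn : ∀ u ∈ L, 0 ≤ f u v := fun u hu => by
      simp only [hf]
      rw [adjInd_of_adj (hG' u hu v hv'.1)]
      exact mul_nonneg (sub_nonneg.2 (adjInd_le_one G u v)) (mul_nonneg (hx u) (hx v))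
    refine le_trans ?_ (Finset.single_le_sum (f := fun u => f u v) hnn hw)
    simp only [hf]
    rw [adjInd_of_adj (hG' w hw v hv'.1), adjInd_of_not_adj hwv]
    nlinarith [hL w hw, hx v]
  have hER : -(m * β * ∑ v ∈ E, x v) ≤ ∑ v ∈ E, ∑ u ∈ R, f v u := by
    rw [Finset.mul_sum, ← Finset.sum_neg_distrib]
    refine Finset.sum_le_sum fun v hv => ?_
    have hv' := (hmemE v).1 hv
    have hβ0 : 0 ≤ β := (hx v).trans (hβ v hv'.1)
    have h1 : ∑ u ∈ R, adjInd G v u * (x v * x u) ≤ m * β * x v := by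
      calc ∑ u ∈ R, adjInd G v u * (x v * x u) ≤ ∑ u ∈ R, adjInd G v u * (x v * β) :=
            Finset.sum_le_sum fun u hu => mul_le_mul_of_nonneg_left
              (mul_le_mul_of_nonneg_left (hβ u ((hR u).1 hu).1) (hx v)) (adjInd_nonneg G _ _)
        _ = (∑ u ∈ R, adjInd G v u) * (x v * β) := by rw [Finset.sum_mul]
        _ ≤ m * (x v * β) := mul_le_mul_of_nonneg_right (hm v hv'.1) (mul_nonneg (hx v) hβ0)
        _ = _ := by ring
    calc -(m * β * x v) ≤ -∑ u ∈ R, adjInd G v u * (x v * x u) := neg_le_neg h1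
      _ ≤ _ := by rw [← Finset.sum_neg_distrib]; exact Finset.sum_le_sum fun u _ => hfge v u
  have hEE : -(4 * C * β * ∑ v ∈ E, x v) ≤ ∑ u ∈ E, ∑ v ∈ E, f u v := by
    refine (neg_le_neg (sum_adjInd_mul_le hsp hx E
      fun v hv => hβ v ((hmemE v).1 hv).1)).trans ?_
    simp only [← Finset.sum_neg_distrib]
    exact Finset.sum_le_sum fun u _ => Finset.sum_le_sum fun v _ => hfge u v
  have htot : ∑ u, ∑ v, f u v = ∑ u, ∑ v, adjInd G' u v * (x u * x v) -
      ∑ u, ∑ v, adjInd G u v * (x u * x v) := by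
    simp only [hf, sub_mul, Finset.sum_sub_distrib]
  have hGe : ∑ u, ∑ v, adjInd G u v * (x u * x v) = lambdaOne G * ∑ u, x u ^ 2 := by
    rw [Finset.mul_sum]
    refine Finset.sum_congr rfl fun u _ => ?_
    rw [pow_two, mul_left_comm, heig u, Finset.mul_sum]
    exact Finset.sum_congr rfl fun v _ => by ring
  have hsq : 0 ≤ ∑ u, x u ^ 2 := Finset.sum_nonneg fun u _ => sq_nonneg _
  have hG'le := rayleigh_le G' x
  have hlam := mul_le_mul_of_nonneg_right hle hsq
  have hdecomp : ∑ u, ∑ v, f u v = ∑ u ∈ L, ∑ v ∈ L, f u v + ∑ u ∈ R, ∑ v ∈ R, f u v +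
      ∑ u ∈ E, ∑ v ∈ E, f u v + 2 * ∑ u ∈ L, ∑ v ∈ R, f u v + 2 * ∑ u ∈ L, ∑ v ∈ E, f u v +
      2 * ∑ v ∈ E, ∑ u ∈ R, f v u := by
    simp_rw [hsplit, Finset.sum_add_distrib]
    have hs : ∀ S T : Finset (Fin n), ∑ u ∈ S, ∑ v ∈ T, f u v = ∑ u ∈ T, ∑ v ∈ S, f u v := by
      intro S T
      rw [Finset.sum_comm]
      exact Finset.sum_congr rfl fun u _ => Finset.sum_congr rfl fun v _ => hfsymm v u
    rw [hs R L, hs E L, hs R E]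
    ring
  have hEx : 0 ≤ ∑ v ∈ E, x v := Finset.sum_nonneg fun v _ => hx v
  -- The `L`-`E` gain counts twice, giving Σ_E x; `hsmall` keeps the losses `E`-`R` (twice) and
  -- `E`-`E` below half of that.
  have hgain : (∑ v ∈ E, x v) / 2 ≤ ∑ u, ∑ v, f u v := by
    rw [hdecomp, hLR]
    nlinarith [mul_le_mul_of_nonneg_right hsmall hEx]
  have hE0 : ∑ v ∈ E, x v = 0 := by linarith
  intro u hu v hv
  by_contra huv
  have hvE : v ∈ E := (hmemE v).2 ⟨hv, fun hvR => huv (((hR v).1 hvR).2 u hu)⟩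
  have hxv : x v = 0 := (Finset.sum_eq_zero_iff_of_nonneg fun w _ => hx w).1 hE0 v hvE
  -- So far `x` only vanishes on `E`, which is possible if `G` is disconnected. But `x` now attains
  -- the maximum for `G'` as well, hence is an eigenvector of `G'`, and the `G'`-edge from `v` to
  -- `u` forces x_v ≠ 0.
  have h1 := eig_of_rayleigh_eq G' (y := x) (by linarith) v
  rw [hxv, mul_zero] at h1
  have h2 := Finset.single_le_sum (f := fun w => adjInd G' v w * x w)
    (fun w _ => mul_nonneg (adjInd_nonneg G' v w) (hx w)) (Finset.mem_univ u)
  simp only [adjInd_of_adj (hG' u hu v hv).symm] at h2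
  linarith [hL u hu]

/-! ### Freeness and edge counts -/

lemma FamilyFree.of_isContained {ℱ : GraphFamily} {V W : Type*} {G' : SimpleGraph V}
    {G : SimpleGraph W} (hG : FamilyFree ℱ G) (h : G' ⊑ G) : FamilyFree ℱ G' :=
  fun F hF hc => hG F hF (hc.trans h)

lemma completeBipartiteGraph_isContained_of_full {V : Type*} [Fintype V] [DecidableEq V]
    {G : SimpleGraph V} (L : Finset V) {k r : ℕ} (hk : L.card = k) (hr : Lᶜ.card = r)
    (hfull : ∀ u ∈ L, ∀ v ∉ L, G.Adj u v) :
    completeBipartiteGraph (Fin k) (Fin r) ⊑ G := by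
  set f := (L.equivFinOfCardEq hk).symm with hf
  set g := (Lᶜ.equivFinOfCardEq hr).symm with hg
  have hgL : ∀ j, (g j : V) ∉ L := fun j => Finset.mem_compl.1 (g j).2
  refine ⟨⟨⟨Sum.elim (fun i => (f i : V)) (fun j => (g j : V)), ?_⟩, ?_⟩⟩
  · rintro (i | i) (j | j) hij
    · simp at hij
    · exact hfull _ (f i).2 _ (hgL j)
    · exact (hfull _ (f j).2 _ (hgL i)).symm
    · simp at hij
  · rintro (i | i) (j | j) hij
    · have : f i = f j := Subtype.ext hij
      rw [f.injective this]
    · exact absurd ((show (f i : V) = g j from hij) ▸ (f i).2) (hgL j)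
    · exact absurd ((show (g i : V) = f j from hij) ▸ (f j).2) (hgL i)
    · have : g i = g j := Subtype.ext hij
      rw [g.injective this]

lemma exists_exNumber_le {ℱ : GraphFamily}
    (hex : (fun n : ℕ => (exNumber n ℱ : ℝ)) =O[atTop] (fun n : ℕ => (n : ℝ))) :
    ∃ C : ℝ, 1 ≤ C ∧ ∀ n : ℕ, n ≠ 0 → (exNumber n ℱ : ℝ) ≤ C * n := by
  obtain ⟨c, hc⟩ := hex.bound
  obtain ⟨N, hN⟩ := eventually_atTop.1 hc
  -- `S` absorbs the finitely many small orders, so the bound holds for every n ≠ 0 and thus for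
  -- subgraphs of any size.
  set S : ℝ := ∑ j ∈ Finset.range N, (exNumber j ℱ : ℝ) with hS
  have hS0 : 0 ≤ S := Finset.sum_nonneg fun j _ => by positivity
  refine ⟨1 + |c| + S, by linarith [abs_nonneg c], fun n hn => ?_⟩
  have hn1 : (1 : ℝ) ≤ n := by exact_mod_cast Nat.one_le_iff_ne_zero.2 hn
  rcases le_or_gt N n with h | h
  · have h1 := hN n h
    simp only [Real.norm_natCast] at h1
    have h2 : c * n ≤ |c| * n := mul_le_mul_of_nonneg_right (le_abs_self c) (by positivity)
    nlinarith
  · have h1 : (exNumber n ℱ : ℝ) ≤ S :=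
      Finset.single_le_sum (f := fun j => (exNumber j ℱ : ℝ)) (fun j _ => by positivity)
        (Finset.mem_range.2 h)
    have h2 : S ≤ S * n := le_mul_of_one_le_right hS0 hn1
    nlinarith [abs_nonneg c, mul_nonneg (abs_nonneg c) (by linarith : (0 : ℝ) ≤ n)]

lemma edgeCount_le_exNumber {ℱ : GraphFamily} {n : ℕ} {G : SimpleGraph (Fin n)}
    (hG : FamilyFree ℱ G) : edgeCount G ≤ exNumber n ℱ := by
  classical
  unfold exNumber
  convert Finset.le_sup (f := edgeCount) (Finset.mem_filter.2 ⟨Finset.mem_univ G, hG⟩)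

/-- The edges inside `S` are the edges of the graph pulled back along an enumeration of `S`. -/
lemma two_mul_edgeCount_comap {V : Type*} [DecidableEq V] (G : SimpleGraph V) (S : Finset V)
    {s : ℕ} (g : Fin s ↪ V) (hg : Finset.univ.map g = S) :
    2 * (edgeCount (G.comap g) : ℝ) = ∑ u ∈ S, ∑ v ∈ S, adjInd G u v := by
  rw [two_mul_edgeCount, ← hg]
  simp only [Finset.sum_map]
  rfl

lemma exists_enum {V : Type*} (S : Finset V) {s : ℕ} (hs : S.card = s) :
    ∃ g : Fin s ↪ V, Finset.univ.map g = S := by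
  refine ⟨(S.equivFinOfCardEq hs).symm.toEmbedding.trans (Function.Embedding.subtype _), ?_⟩
  ext v
  simp only [Finset.mem_map, Finset.mem_univ, true_and, Function.Embedding.trans_apply,
    Equiv.coe_toEmbedding, Function.Embedding.subtype_apply]
  constructor
  · rintro ⟨i, rfl⟩
    exact Subtype.prop _
  · intro hv
    exact ⟨S.equivFinOfCardEq hs ⟨v, hv⟩, by simp⟩

lemma comap_isContained {V W : Type*} (G : SimpleGraph V) (g : W ↪ V) : G.comap g ⊑ G :=
  ⟨⟨⟨g, fun h => h⟩, g.injective⟩⟩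

lemma FamilyFree.sum_adjInd_le {ℱ : GraphFamily} {C : ℝ}
    (hC : ∀ n : ℕ, n ≠ 0 → (exNumber n ℱ : ℝ) ≤ C * n) {V : Type*} [DecidableEq V]
    {G : SimpleGraph V} (hG : FamilyFree ℱ G) (S : Finset V) :
    ∑ u ∈ S, ∑ v ∈ S, adjInd G u v ≤ 2 * C * S.card := by
  rcases S.eq_empty_or_nonempty with rfl | hne
  · simp
  obtain ⟨g, hg⟩ := exists_enum S rfl
  rw [← two_mul_edgeCount_comap G S g hg, mul_assoc]
  have h1 := edgeCount_le_exNumber (hG.of_isContained (comap_isContained G g))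
  have h2 := hC S.card (Finset.card_pos.2 hne).ne'
  have h3 : (edgeCount (G.comap g) : ℝ) ≤ exNumber S.card ℱ := by exact_mod_cast h1
  linarith

/-- If `K_{k+1,∞}` is not `ℱ`-free, then the common neighbourhoods of `k + 1` vertices in
`ℱ`-free graphs are bounded. -/
lemma exists_common_lt {ℱ : GraphFamily} {k : ℕ}
    (hK : ¬ FamilyFree ℱ (completeBipartiteGraph (Fin (k + 1)) ℕ)) :
    ∃ m : ℕ, ∀ {V : Type} (G : SimpleGraph V), FamilyFree ℱ G → ∀ T N : Finset V,
      T.card = k + 1 → (∀ t ∈ T, ∀ u ∈ N, G.Adj t u) → N.card < m := by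
  simp only [FamilyFree, SimpleGraph.Free, not_forall, not_not] at hK
  obtain ⟨⟨p, F⟩, hF, ⟨f⟩⟩ := hK
  set b : Fin (k + 1) ⊕ ℕ → ℕ := Sum.elim (fun _ => 0) id with hb
  set m := Finset.univ.sup (fun i => b (f i)) + 1 with hm
  have hbm : ∀ i, b (f i) < m := fun i =>
    Nat.lt_succ_of_le (Finset.le_sup (f := fun i => b (f i)) (Finset.mem_univ i))
  refine ⟨m, fun {V} G hG T N' hT hTN => ?_⟩
  by_contra! hcard
  obtain ⟨N, hN, hNc⟩ := Finset.exists_subset_card_eq hcard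
  obtain ⟨t, ht⟩ := exists_enum T hT
  obtain ⟨r, hr⟩ := exists_enum N hNc
  have htT : ∀ i, t i ∈ T := fun i => ht ▸ Finset.mem_map_of_mem t (Finset.mem_univ i)
  have hrN : ∀ i j, G.Adj (t i) (r j) := fun i j =>
    hTN _ (htT i) _ (hN (hr ▸ Finset.mem_map_of_mem r (Finset.mem_univ j)))
  set g : Fin (k + 1) ⊕ ℕ → V := Sum.elim t fun a => if h : a < m then r ⟨a, h⟩ else t 0 with hg
  have hadj : ∀ i a, a < m → G.Adj (g (Sum.inl i)) (g (Sum.inr a)) := by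
    intro i a ha
    simp only [hg, Sum.elim_inl, Sum.elim_inr, dif_pos ha]
    exact hrN _ _
  refine hG _ hF ⟨⟨⟨fun i => g (f i), ?_⟩, ?_⟩⟩
  · intro i j hij
    have h1 := f.toHom.map_adj hij
    have hi := hbm i
    have hj := hbm j
    change (completeBipartiteGraph (Fin (k + 1)) ℕ).Adj (f i) (f j) at h1
    change G.Adj (g (f i)) (g (f j))
    rcases hfi : f i with a | a <;> rcases hfj : f j with c | c <;> rw [hfi, hfj] at h1
    · simp at h1
    · rw [hfj] at hj; exact hadj a c hj
    · rw [hfi] at hi; exact (hadj c a hi).symm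
    · simp at h1
  · intro i j hij
    apply f.injective
    have hi := hbm i
    have hj := hbm j
    change g (f i) = g (f j) at hij
    change f i = f j
    rcases hfi : f i with a | a <;> rcases hfj : f j with c | c <;> rw [hfi, hfj] at hij
    · rw [t.injective hij]
    · rw [hfj] at hj; exact absurd hij (hadj a c hj).ne
    · rw [hfi] at hi; exact absurd hij.symm (hadj c a hi).ne
    · rw [hfi] at hi; rw [hfj] at hj
      simp only [hb, Sum.elim_inr, id] at hi hj
      simp only [hg, Sum.elim_inr, dif_pos hi, dif_pos hj] at hij
      have := r.injective hij
      simp only [Fin.mk.injEq] at this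
      rw [this]

/-- The edges inside `L` and inside its common neighbourhood `R` are at most as many as those
that the extremal graph containing `K_{k,|R|}` has in excess of `k |R|`. -/
lemma sum_adjInd_le_of_EXContaining {ℱ : GraphFamily} {V : Type*} [DecidableEq V]
    {G : SimpleGraph V} (hG : FamilyFree ℱ G) {L R : Finset V} {k s : ℕ} (hL : L.card = k)
    (hLR : Disjoint L R) (hs : (L ∪ R).card = s)
    (hadj : ∀ u ∈ L, ∀ v ∈ R, G.Adj u v) {H : SimpleGraph (Fin s)}
    (hH : H ∈ EXContaining (completeBipartiteGraph (Fin k) (Fin (s - k))) s ℱ) :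
    ∑ u ∈ L, ∑ v ∈ L, adjInd G u v + ∑ u ∈ R, ∑ v ∈ R, adjInd G u v + 2 * (k * R.card) ≤
      2 * edgeCount H := by
  obtain ⟨g, hg⟩ := exists_enum (L ∪ R) hs
  have hgm : ∀ i, g i ∈ L ∪ R := fun i => hg ▸ Finset.mem_map_of_mem g (Finset.mem_univ i)
  set L' : Finset (Fin s) := Finset.univ.filter fun i => g i ∈ L with hL'
  have hmap : L'.map g = L := by
    ext v
    simp only [hL', Finset.mem_map, Finset.mem_filter, Finset.mem_univ, true_and]
    constructor
    · rintro ⟨i, hi, rfl⟩; exact hi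
    · intro hv
      obtain ⟨i, -, rfl⟩ := Finset.mem_map.1 (hg.symm ▸ Finset.mem_union_left R hv)
      exact ⟨i, hv, rfl⟩
  have hL'c : L'.card = k := by rw [← Finset.card_map g, hmap, hL]
  have hcont : completeBipartiteGraph (Fin k) (Fin (s - k)) ⊑ G.comap g := by
    refine completeBipartiteGraph_isContained_of_full L' hL'c ?_ fun u hu v hv => ?_
    · rw [Finset.card_compl, hL'c, Fintype.card_fin]
    · have hv' : g v ∉ L := by simpa [hL'] using hv
      exact hadj _ (Finset.mem_filter.1 hu).2 _ ((Finset.mem_union.1 (hgm v)).resolve_left hv')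
  -- The subgraph induced on `L ∪ R` is `ℱ`-free and contains K_{k,|R|}, so it competes with `H` at
  -- order `s`.
  have h1 := hH.2.2 _ (hG.of_isContained (comap_isContained G g)) hcont
  have h2 : (edgeCount (G.comap g) : ℝ) ≤ edgeCount H := by exact_mod_cast h1
  have h3 := two_mul_edgeCount_comap G (L ∪ R) g hg
  simp_rw [Finset.sum_union hLR, Finset.sum_add_distrib] at h3
  have h4 : ∑ u ∈ L, ∑ v ∈ R, adjInd G u v = k * R.card := by
    rw [Finset.sum_congr rfl fun u hu => Finset.sum_congr rfl fun v hv =>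
      adjInd_of_adj (hadj u hu v hv)]
    simp [hL]
  have h5 : ∑ v ∈ R, ∑ u ∈ L, adjInd G v u = k * R.card := by
    rw [← h4, Finset.sum_comm]
    exact Finset.sum_congr rfl fun u _ => Finset.sum_congr rfl fun v _ => adjInd_comm G _ _
  linarith

/-! ### Comparison graphs -/

/-- Keep the edges of `G` among `L` and its common neighbourhood `R`, and join all the
remaining vertices to `L` only. -/
def reattach {V : Type*} (G : SimpleGraph V) (L R : Set V) : SimpleGraph V where
  Adj u v := (u ∈ L ∧ v ∉ L) ∨ (u ∉ L ∧ v ∈ L) ∨ (G.Adj u v ∧ u ∈ L ∪ R ∧ v ∈ L ∪ R)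
  symm := ⟨fun u v h => by
    rcases h with h | h | h
    · exact Or.inr (Or.inl ⟨h.2, h.1⟩)
    · exact Or.inl ⟨h.2, h.1⟩
    · exact Or.inr (Or.inr ⟨h.1.symm, h.2.2, h.2.1⟩)⟩
  loopless := ⟨fun u h => by
    rcases h with h | h | h
    · exact h.2 h.1
    · exact h.1 h.2
    · exact G.loopless.irrefl u h.1⟩

/-- In a copy of `F`, replace the vertices outside `L ∪ R` by unused vertices of `R`. The former are
adjacent only to `L`, and `R` is completely joined to `L` in `G`, so this yields a copy in `G`. The
size condition leaves enough unused vertices. -/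
lemma familyFree_reattach {ℱ : GraphFamily} {V : Type*} [DecidableEq V] {G : SimpleGraph V}
    (hG : FamilyFree ℱ G) (L R : Finset V)
    (hadj : ∀ u ∈ L, ∀ v ∈ R, G.Adj u v) (hbig : ∀ F ∈ ℱ, 2 * F.1 ≤ R.card) :
    FamilyFree ℱ (reattach G L R) := by
  rintro ⟨p, F⟩ hF ⟨f⟩
  have hcard : p ≤ (R \ Finset.univ.image f).card := by
    have h1 : (Finset.univ.image f).card ≤ p := by
      simpa using Finset.card_image_le (s := Finset.univ) (f := f)
    have h2 := Finset.le_card_sdiff (Finset.univ.image f) R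
    have h3 := hbig _ hF
    simp only at h3
    omega
  obtain ⟨N, hN, hNc⟩ := Finset.exists_subset_card_eq hcard
  obtain ⟨g, hg⟩ := exists_enum N hNc
  have hgN : ∀ i, g i ∈ R ∧ ∀ j, f j ≠ g i := by
    intro i
    have := Finset.mem_sdiff.1 (hN (hg ▸ Finset.mem_map_of_mem g (Finset.mem_univ i)))
    exact ⟨this.1, fun j hj => this.2 (Finset.mem_image.2 ⟨j, Finset.mem_univ j, hj⟩)⟩
  set h : Fin p → V := fun i => if f i ∈ L ∪ R then f i else g i with hh
  have hhL : ∀ i, f i ∈ L → h i = f i := fun i hi => by simp [hh, hi]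
  have hhR : ∀ i, f i ∉ L → h i ∈ R := by
    intro i hi
    by_cases hR : f i ∈ R
    · simp [hh, hR]
    · simp [hh, hi, hR, (hgN i).1]
  refine hG _ hF ⟨⟨⟨h, ?_⟩, ?_⟩⟩
  · intro i j hij
    rcases (f.toHom.map_adj hij : (reattach G L R).Adj (f i) (f j)) with hc | hc | hc
    · rw [hhL i hc.1]
      exact hadj _ hc.1 _ (hhR j hc.2)
    · rw [hhL j hc.2]
      exact (hadj _ hc.2 _ (hhR i hc.1)).symm
    · have hi : f i ∈ L ∪ R := by simpa using hc.2.1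
      have hj : f j ∈ L ∪ R := by simpa using hc.2.2
      simp only [hh, if_pos hi, if_pos hj]
      exact hc.1
  · intro i j hij
    change h i = h j at hij
    simp only [hh] at hij
    split_ifs at hij
    · exact f.injective hij
    · exact absurd hij ((hgN j).2 i)
    · exact absurd hij.symm ((hgN i).2 j)
    · exact g.injective hij

section Enumeration

lemma FamilyFree.comap_equiv {ℱ : GraphFamily} {U V W : Type*} {H : SimpleGraph U} {Y : SimpleGraph W} (hH : FamilyFree ℱ H)
    (hY : Nonempty (H ≃g Y)) (e : V ≃ W) : FamilyFree ℱ (Y.comap e) := by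
  obtain ⟨φ⟩ := hY
  exact hH.of_isContained ⟨Iso.toCopy ((Iso.comap e Y).trans φ.symm)⟩

variable {V : Type*} [Fintype V] [DecidableEq V]

lemma exists_equiv_sum (P : Finset V) {a b : ℕ} (ha : P.card = a)
    (hb : Fintype.card V = a + b) :
    ∃ e : V ≃ Fin a ⊕ Fin b, (∀ v ∈ P, ∃ i, e v = Sum.inl i) ∧ ∀ v ∉ P, ∃ j, e v = Sum.inr j := by
  have h1 : Fintype.card {v // v ∈ P} = a := by simpa using ha
  have h2 : Fintype.card {v // v ∉ P} = b := by
    rw [Fintype.card_subtype_compl, hb, h1]; omega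
  refine ⟨(Equiv.sumCompl (· ∈ P)).symm.trans
    (Equiv.sumCongr (Fintype.equivFinOfCardEq h1) (Fintype.equivFinOfCardEq h2)), ?_, ?_⟩
  · intro v hv
    simp [Equiv.sumCompl_symm_apply_of_pos hv]
  · intro v hv
    simp [Equiv.sumCompl_symm_apply_of_neg hv]

/-! ### Placing the extremal graph with its `k`-part on a given set -/

variable {ℱ : GraphFamily} {n k : ℕ} {H : SimpleGraph (Fin n)}

lemma exists_full_of_completeBipartite (hH : FamilyFree ℱ H)
    (hiso : Nonempty (H ≃g completeBipartiteGraph (Fin k) (Fin (n - k))))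
    (L : Finset (Fin n)) (hL : L.card = k) :
    ∃ T : SimpleGraph (Fin n), FamilyFree ℱ T ∧ ∀ u ∈ L, ∀ v ∉ L, T.Adj u v := by
  have hkn : k ≤ n := by simpa [hL] using Finset.card_le_univ L
  obtain ⟨e, he1, he2⟩ := exists_equiv_sum L hL (b := n - k) (by simp; omega)
  refine ⟨_, hH.comap_equiv hiso e, fun u hu v hv => ?_⟩
  obtain ⟨i, hi⟩ := he1 u hu
  obtain ⟨j, hj⟩ := he2 v hv
  simp [hi, hj]

lemma exists_full_of_graphJoin {X : SimpleGraph (Fin (n - k))} (hH : FamilyFree ℱ H)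
    (hiso : Nonempty (H ≃g graphJoin (⊤ : SimpleGraph (Fin k)) X))
    (L : Finset (Fin n)) (hL : L.card = k) :
    ∃ T : SimpleGraph (Fin n), FamilyFree ℱ T ∧ (∀ u ∈ L, ∀ v ∉ L, T.Adj u v) ∧
      ∀ u ∈ L, ∀ v ∈ L, u ≠ v → T.Adj u v := by
  have hkn : k ≤ n := by simpa [hL] using Finset.card_le_univ L
  obtain ⟨e, he1, he2⟩ := exists_equiv_sum L hL (b := n - k) (by simp; omega)
  refine ⟨_, hH.comap_equiv hiso e, fun u hu v hv => ?_, fun u hu v hv huv => ?_⟩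
  · obtain ⟨i, hi⟩ := he1 u hu
    obtain ⟨j, hj⟩ := he2 v hv
    simp [hi, hj, graphJoin]
  · obtain ⟨i, hi⟩ := he1 u hu
    obtain ⟨j, hj⟩ := he1 v hv
    have : i ≠ j := fun h => huv (e.injective (by rw [hi, hj, h]))
    simp [hi, hj, graphJoin, this]

lemma exists_full_of_graphJoin_edge (hH : FamilyFree ℱ H)
    (hiso : Nonempty (H ≃g graphJoin (⊤ : SimpleGraph (Fin k))
      ((⊤ : SimpleGraph (Fin 2)) ⊕g (⊥ : SimpleGraph (Fin (n - k - 2))))))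
    (L : Finset (Fin n)) (hL : L.card = k) {p q : Fin n} (hp : p ∉ L) (hq : q ∉ L)
    (hpq : p ≠ q) :
    ∃ T : SimpleGraph (Fin n), FamilyFree ℱ T ∧ (∀ u ∈ L, ∀ v ∉ L, T.Adj u v) ∧
      (∀ u ∈ L, ∀ v ∈ L, u ≠ v → T.Adj u v) ∧ T.Adj p q := by
  have hkn : k ≤ n := by simpa [hL] using Finset.card_le_univ L
  obtain ⟨e, he1, he2⟩ := exists_equiv_sum L hL (b := n - k) (by simp; omega)
  obtain ⟨p', hp'⟩ := he2 p hp
  obtain ⟨q', hq'⟩ := he2 q hq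
  have hpq' : p' ≠ q' := fun h => hpq (e.injective (by rw [hp', hq', h]))
  have h2 : 2 ≤ n - k := by
    simpa [Finset.card_pair hpq'] using Finset.card_le_univ ({p', q'} : Finset (Fin (n - k)))
  obtain ⟨e', he1', -⟩ := exists_equiv_sum {p', q'} (Finset.card_pair hpq') (b := n - k - 2)
    (by simp; omega)
  refine ⟨_, hH.comap_equiv hiso (e.trans (Equiv.sumCongr (Equiv.refl _) e')),
    fun u hu v hv => ?_, fun u hu v hv huv => ?_, ?_⟩
  · obtain ⟨i, hi⟩ := he1 u hu
    obtain ⟨j, hj⟩ := he2 v hv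
    simp [hi, hj, graphJoin]
  · obtain ⟨i, hi⟩ := he1 u hu
    obtain ⟨j, hj⟩ := he1 v hv
    have : i ≠ j := fun h => huv (e.injective (by rw [hi, hj, h]))
    simp [hi, hj, graphJoin, this]
  · obtain ⟨i, hi⟩ := he1' p' (by simp)
    obtain ⟨j, hj⟩ := he1' q' (by simp)
    have : i ≠ j := fun h => hpq' (e'.injective (by rw [hi, hj, h]))
    simp [hp', hq', hi, hj, graphJoin, this]

/-! ### Edge counts of the extremal graphs -/

lemma two_mul_edgeCount_of_iso {V W : Type*} [Fintype V] [Fintype W] {H : SimpleGraph V}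
    {Y : SimpleGraph W} (e : H ≃g Y) :
    2 * (edgeCount H : ℝ) = ∑ i, ∑ j, adjInd Y i j := by
  rw [two_mul_edgeCount, ← Equiv.sum_comp e.toEquiv]
  refine Finset.sum_congr rfl fun u _ => ?_
  rw [← Equiv.sum_comp e.toEquiv]
  exact Finset.sum_congr rfl fun v _ => (adjInd_iso e u v).symm

lemma sum_adjInd_top (k : ℕ) :
    ∑ i, ∑ j, adjInd (⊤ : SimpleGraph (Fin k)) i j = k * (k - 1) := by
  have : ∀ i j, adjInd (⊤ : SimpleGraph (Fin k)) i j = 1 - if i = j then 1 else 0 := by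
    intro i j
    by_cases h : i = j <;> simp [adjInd, h]
  simp [this, mul_sub]

lemma sum_adjInd_completeBipartite (k r : ℕ) :
    ∑ i, ∑ j, adjInd (completeBipartiteGraph (Fin k) (Fin r)) i j = 2 * (k * r) := by
  simp only [Fintype.sum_sum_type, adjInd, completeBipartiteGraph_adj, Sum.isLeft_inl,
    Sum.isRight_inl, Sum.isLeft_inr, Sum.isRight_inr]
  simp
  ring

lemma sum_adjInd_graphJoin {A B : Type*} [Fintype A] [Fintype B] (X : SimpleGraph A)
    (Y : SimpleGraph B) :
    ∑ i, ∑ j, adjInd (graphJoin X Y) i j = ∑ i, ∑ j, adjInd X i j + ∑ i, ∑ j, adjInd Y i j +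
      2 * (Fintype.card A * Fintype.card B) := by
  have h1 : ∀ i j, adjInd (graphJoin X Y) (Sum.inl i) (Sum.inl j) = adjInd X i j := by
    classical exact fun i j => if_congr (by simp [graphJoin]) rfl rfl
  have h2 : ∀ i j, adjInd (graphJoin X Y) (Sum.inr i) (Sum.inr j) = adjInd Y i j := by
    classical exact fun i j => if_congr (by simp [graphJoin]) rfl rfl
  have h3 : ∀ i j, adjInd (graphJoin X Y) (Sum.inl i) (Sum.inr j) = 1 := by
    intro i j; simp [adjInd, graphJoin]
  have h4 : ∀ i j, adjInd (graphJoin X Y) (Sum.inr i) (Sum.inl j) = 1 := by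
    intro i j; simp [adjInd, graphJoin]
  simp only [Fintype.sum_sum_type, h1, h2, h3, h4, Finset.sum_add_distrib, Finset.sum_const,
    Finset.card_univ, nsmul_eq_mul, mul_one]
  ring

lemma sum_adjInd_edge (r : ℕ) :
    ∑ i, ∑ j, adjInd ((⊤ : SimpleGraph (Fin 2)) ⊕g (⊥ : SimpleGraph (Fin r))) i j = 2 := by
  have h1 : ∀ i j, adjInd ((⊤ : SimpleGraph (Fin 2)) ⊕g (⊥ : SimpleGraph (Fin r)))
      (Sum.inl i) (Sum.inl j) = adjInd (⊤ : SimpleGraph (Fin 2)) i j := by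
    intro i j; simp [adjInd]
  simp only [Fintype.sum_sum_type, h1, Finset.sum_add_distrib, sum_adjInd_top]
  simp [adjInd]
  norm_num

end Enumeration

/-! ### Comparing the weights inside `L` and `R` -/

section Weights

variable {V : Type*} {G T : SimpleGraph V} {x : V → ℝ} {L R : Finset V}

lemma sum_adjInd_clique [DecidableEq V] (hT : ∀ u ∈ L, ∀ v ∈ L, u ≠ v → T.Adj u v) :
    ∑ u ∈ L, ∑ v ∈ L, adjInd T u v = L.card * (L.card - 1) := by
  rw [← nsmul_eq_mul]
  refine Finset.sum_eq_card_nsmul fun u hu => ?_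
  rw [← Finset.add_sum_erase L _ hu, adjInd_self, zero_add,
    Finset.sum_congr rfl fun v hv => adjInd_of_adj
      (hT u hu v (Finset.mem_of_mem_erase hv) (Finset.ne_of_mem_erase hv).symm),
    Finset.sum_const, nsmul_eq_mul, mul_one, Finset.card_erase_of_mem hu,
    Nat.cast_sub (Finset.card_pos.2 ⟨u, hu⟩), Nat.cast_one]

/-- Each ordered pair missing inside `L` is regained with weight at least 1/4. -/
lemma le_sum_weights_clique [DecidableEq V] (hT : ∀ u ∈ L, ∀ v ∈ L, u ≠ v → T.Adj u v)
    (hx : ∀ v ∈ L, 1 / 2 ≤ x v) :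
    (L.card * (L.card - 1) - ∑ u ∈ L, ∑ v ∈ L, adjInd G u v) / 4 ≤
      ∑ u ∈ L, ∑ v ∈ L, (adjInd T u v - adjInd G u v) * (x u * x v) := by
  rw [← sum_adjInd_clique hT]
  simp only [← Finset.sum_sub_distrib, Finset.sum_div]
  refine Finset.sum_le_sum fun u hu => Finset.sum_le_sum fun v hv => ?_
  have h0 : 0 ≤ adjInd T u v - adjInd G u v := by
    rcases eq_or_ne u v with rfl | huv
    · simp [adjInd_self]
    · rw [adjInd_of_adj (hT u hu v hv huv)]
      exact sub_nonneg.2 (adjInd_le_one G u v)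
  have h1 : 1 / 4 ≤ x u * x v := by nlinarith [hx u hu, hx v hv]
  rw [div_eq_mul_one_div]
  exact mul_le_mul_of_nonneg_left h1 h0

/-- Each ordered adjacent pair lost inside `R` costs at most β². -/
lemma neg_le_sum_weights {β : ℝ} (hx0 : ∀ v, 0 ≤ x v) (hx : ∀ v ∈ R, x v ≤ β) :
    -(β ^ 2 * ∑ u ∈ R, ∑ v ∈ R, adjInd G u v) ≤
      ∑ u ∈ R, ∑ v ∈ R, (adjInd T u v - adjInd G u v) * (x u * x v) := by
  simp only [Finset.mul_sum, ← Finset.sum_neg_distrib]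
  refine Finset.sum_le_sum fun u hu => Finset.sum_le_sum fun v hv => ?_
  have h1 : x u * x v ≤ β ^ 2 := by
    rw [pow_two]
    exact mul_le_mul (hx u hu) (hx v hv) (hx0 v) ((hx0 u).trans (hx u hu))
  have h2 := mul_le_mul_of_nonneg_left h1 (adjInd_nonneg G u v)
  have h3 := mul_nonneg (adjInd_nonneg T u v) (mul_nonneg (hx0 u) (hx0 v))
  nlinarith

lemma sum_weights_nonneg (hx0 : ∀ v, 0 ≤ x v) (h : ∀ u ∈ R, ∀ v ∈ R, G.Adj u v → T.Adj u v) :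
    0 ≤ ∑ u ∈ R, ∑ v ∈ R, (adjInd T u v - adjInd G u v) * (x u * x v) := by
  refine Finset.sum_nonneg fun u hu => Finset.sum_nonneg fun v hv =>
    mul_nonneg (sub_nonneg.2 ?_) (mul_nonneg (hx0 u) (hx0 v))
  by_cases huv : G.Adj u v
  · rw [adjInd_of_adj (h u hu v hv huv)]; exact adjInd_le_one G u v
  · rw [adjInd_of_not_adj huv]; exact adjInd_nonneg T u v

lemma exists_nat_sum_adjInd (G : SimpleGraph V) (S : Finset V) :
    ∃ N : ℕ, ∑ u ∈ S, ∑ v ∈ S, adjInd G u v = N := by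
  classical
  refine ⟨∑ u ∈ S, (S.filter fun v => G.Adj u v).card, ?_⟩
  rw [Nat.cast_sum]
  refine Finset.sum_congr rfl fun u _ => ?_
  rw [sum_adjInd_eq_card]

lemma sum_adjInd_le_clique [DecidableEq V] (G : SimpleGraph V) (L : Finset V) :
    ∑ u ∈ L, ∑ v ∈ L, adjInd G u v ≤ L.card * (L.card - 1) := by
  rw [← sum_adjInd_clique (T := ⊤) (L := L) fun u _ v _ h => h]
  refine Finset.sum_le_sum fun u _ => Finset.sum_le_sum fun v _ => ?_
  by_cases huv : G.Adj u v
  · rw [adjInd_of_adj huv, adjInd_of_adj (show (⊤ : SimpleGraph V).Adj u v from huv.ne)]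
  · rw [adjInd_of_not_adj huv]; exact adjInd_nonneg _ u v

/-- If at most one edge lies inside `R`, it is unique. -/
lemma eq_or_eq_of_sum_adjInd_le_two [DecidableEq V] (h : ∑ u ∈ R, ∑ v ∈ R, adjInd G u v ≤ 2) {p q u v : V}
    (hp : p ∈ R) (hq : q ∈ R) (hpq : G.Adj p q) (hu : u ∈ R) (hv : v ∈ R) (huv : G.Adj u v) :
    (u = p ∧ v = q) ∨ (u = q ∧ v = p) := by
  by_contra! hcon
  have hsub : ({(p, q), (q, p), (u, v)} : Finset (V × V)) ⊆ R ×ˢ R := by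
    intro z hz
    simp only [Finset.mem_insert, Finset.mem_singleton] at hz
    rcases hz with rfl | rfl | rfl <;> simp [*]
  have hcard : ({(p, q), (q, p), (u, v)} : Finset (V × V)).card = 3 := by
    have h1 : (p, q) ≠ (q, p) := fun h => hpq.ne (Prod.ext_iff.1 h).1
    have h2 : (p, q) ≠ (u, v) := fun h =>
      hcon.1 (Prod.ext_iff.1 h).1.symm (Prod.ext_iff.1 h).2.symm
    have h3 : (q, p) ≠ (u, v) := fun h =>
      hcon.2 (Prod.ext_iff.1 h).1.symm (Prod.ext_iff.1 h).2.symm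
    exact Finset.card_eq_three.2 ⟨_, _, _, h1, h2, h3, rfl⟩
  have hle := Finset.sum_le_sum_of_subset_of_nonneg (f := fun z : V × V => adjInd G z.1 z.2) hsub
    fun z _ _ => adjInd_nonneg G _ _
  rw [Finset.sum_product] at hle
  have h3 : ∑ z ∈ ({(p, q), (q, p), (u, v)} : Finset (V × V)), adjInd G z.1 z.2 = 3 := by
    have : ∀ z ∈ ({(p, q), (q, p), (u, v)} : Finset (V × V)), adjInd G z.1 z.2 = 1 := by
      intro z hz
      simp only [Finset.mem_insert, Finset.mem_singleton] at hz
      rcases hz with rfl | rfl | rfl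
      exacts [adjInd_of_adj hpq, adjInd_of_adj hpq.symm, adjInd_of_adj huv]
    rw [Finset.sum_congr rfl this, Finset.sum_const, hcard]
    norm_num
  simp only at hle
  linarith

end Weights

/-! ### The comparison graph in each case -/

/-- In `ℱ`-free graphs of order `n` with `k` large entries at `L` one can compare with an
`ℱ`-free graph which contains all edges between `L` and the rest and which is not worse inside
`L` and inside the common neighbourhood of `L`. -/
def HasComparison (ℱ : GraphFamily) (k n : ℕ) : Prop :=
  ∀ G : SimpleGraph (Fin n), FamilyFree ℱ G → ∀ (x : Fin n → ℝ) (β : ℝ) (L R : Finset (Fin n)),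
    (∀ v, 0 ≤ x v) → β ≤ 1 / 4 → L.card = k → (∀ v ∈ L, 1 / 2 ≤ x v) → (∀ v ∉ L, x v ≤ β) →
    (∀ v, v ∈ R ↔ v ∉ L ∧ ∀ u ∈ L, G.Adj u v) → n ≤ 2 * R.card →
    ∃ G' : SimpleGraph (Fin n), FamilyFree ℱ G' ∧ (∀ u ∈ L, ∀ v ∉ L, G'.Adj u v) ∧
      0 ≤ ∑ u ∈ L, ∑ v ∈ L, (adjInd G' u v - adjInd G u v) * (x u * x v) +
        ∑ u ∈ R, ∑ v ∈ R, (adjInd G' u v - adjInd G u v) * (x u * x v)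

section Cases

variable {ℱ : GraphFamily} {k : ℕ}

/-- `reattach` changes nothing inside `L` or inside `R`, so both weight differences vanish.
Finiteness bounds the orders of the forbidden graphs, and `R` eventually has twice that size. -/
lemma eventually_hasComparison_of_finite (hℱ : ℱ.Finite) (k : ℕ) :
    ∀ᶠ n in atTop, HasComparison ℱ k n := by
  obtain ⟨M, hM⟩ := (hℱ.image fun F => F.1).bddAbove
  have hM' : ∀ F ∈ ℱ, F.1 ≤ M := fun F hF => hM (Set.mem_image_of_mem _ hF)
  filter_upwards [eventually_ge_atTop (4 * M)] with n hn G hG x β L R _ _ _ _ _ hR hRn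
  refine ⟨reattach G L R, familyFree_reattach hG L R (fun u hu v hv => ((hR v).1 hv).2 u hu)
    fun F hF => ?_, fun u hu v hv => Or.inl ⟨hu, hv⟩, le_of_eq ?_⟩
  · have := hM' F hF
    omega
  · have key : ∀ u ∈ L ∪ R, ∀ v ∈ L ∪ R, ((u ∈ L ↔ v ∈ L)) →
        (adjInd (reattach G L R) u v - adjInd G u v) * (x u * x v) = 0 := by
      intro u hu v hv huv
      have : (reattach G L R).Adj u v ↔ G.Adj u v := by
        simp only [reattach, Finset.mem_coe, Set.mem_union]
        rw [Finset.mem_union] at hu hv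
        tauto
      by_cases h : G.Adj u v
      · rw [adjInd_of_adj h, adjInd_of_adj (this.2 h)]; ring
      · rw [adjInd_of_not_adj h, adjInd_of_not_adj (fun h' => h (this.1 h'))]; ring
    rw [Finset.sum_eq_zero fun u hu => Finset.sum_eq_zero fun v hv =>
        key u (Finset.mem_union_left R hu) v (Finset.mem_union_left R hv) (by simp [hu, hv]),
      Finset.sum_eq_zero fun u hu => Finset.sum_eq_zero fun v hv =>
        key u (Finset.mem_union_right L hu) v (Finset.mem_union_right L hv)
          (by simp [((hR u).1 hu).1, ((hR v).1 hv).1]), add_zero]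

variable {H : ∀ n, SimpleGraph (Fin n)}

/-- The excess edge count of the extremal graphs bounds the edges inside `L` and `R`. -/
lemma sum_adjInd_le_excess
    (hH : ∀ᶠ n in atTop, H n ∈ EXContaining (completeBipartiteGraph (Fin k) (Fin (n - k))) n ℱ)
    {b : ℝ} (hb : ∀ᶠ n in atTop, 2 * (edgeCount (H n) : ℝ) = 2 * (k * (n - k : ℕ)) + b) :
    ∀ᶠ n in atTop, ∀ G : SimpleGraph (Fin n), FamilyFree ℱ G → ∀ L R : Finset (Fin n),
      L.card = k → (∀ v, v ∈ R ↔ v ∉ L ∧ ∀ u ∈ L, G.Adj u v) → n ≤ 2 * R.card →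
      ∑ u ∈ L, ∑ v ∈ L, adjInd G u v + ∑ u ∈ R, ∑ v ∈ R, adjInd G u v ≤ b := by
  obtain ⟨N, hN⟩ := eventually_atTop.1 (hH.and hb)
  -- The extremal graph is used at order k + |R| rather than n; as |R| ≥ n/2 ≥ N, this order is
  -- large enough too.
  filter_upwards [eventually_ge_atTop (2 * N)] with n hn G hG L R hL hR hRn
  have hd : Disjoint L R := by
    rw [Finset.disjoint_right]; exact fun v hv => ((hR v).1 hv).1
  have hs : (L ∪ R).card = k + R.card := by rw [Finset.card_union_of_disjoint hd, hL]
  obtain ⟨h1, h2⟩ := hN (k + R.card) (by omega)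
  have h3 := sum_adjInd_le_of_EXContaining hG hL hd hs
    (fun u hu v hv => ((hR v).1 hv).2 u hu) h1
  rw [h2, Nat.add_sub_cancel_left] at h3
  linarith

/-- The excess over K_{k,|R|} is zero, so `G` has no edges inside `L` or `R` and nothing can be lost
there. -/
lemma eventually_hasComparison_of_caseA
    (hH : ∀ᶠ n in atTop, H n ∈ EXContaining (completeBipartiteGraph (Fin k) (Fin (n - k))) n ℱ)
    (hA : CaseA k H) : ∀ᶠ n in atTop, HasComparison ℱ k n := by
  have hb : ∀ᶠ n in atTop, 2 * (edgeCount (H n) : ℝ) = 2 * (k * (n - k : ℕ)) + 0 := by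
    filter_upwards [hA] with n ⟨e⟩
    rw [two_mul_edgeCount_of_iso e, sum_adjInd_completeBipartite, add_zero]
  filter_upwards [hH, hA, sum_adjInd_le_excess hH hb] with n hHn hAn hexc G hG x β L R hx0 _ hL
    _ _ hR hRn
  obtain ⟨T, hT, hfull⟩ := exists_full_of_completeBipartite hHn.1 hAn L hL
  refine ⟨T, hT, hfull, ?_⟩
  have h1 := hexc G hG L R hL hR hRn
  have hnn : ∀ S : Finset (Fin n), 0 ≤ ∑ u ∈ S, ∑ v ∈ S, adjInd G u v := fun S =>
    Finset.sum_nonneg fun u _ => Finset.sum_nonneg fun v _ => adjInd_nonneg G u v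
  have hz : ∀ S : Finset (Fin n), ∑ u ∈ S, ∑ v ∈ S, adjInd G u v ≤ 0 →
      ∀ u ∈ S, ∀ v ∈ S, G.Adj u v → T.Adj u v := by
    intro S hS u hu v hv huv
    have h2 := (Finset.sum_eq_zero_iff_of_nonneg fun u _ =>
      Finset.sum_nonneg fun v _ => adjInd_nonneg G u v).1 (le_antisymm hS (hnn S)) u hu
    have h3 := (Finset.sum_eq_zero_iff_of_nonneg fun v _ => adjInd_nonneg G u v).1 h2 v hv
    rw [adjInd_of_adj huv] at h3
    norm_num at h3
  exact add_nonneg (sum_weights_nonneg hx0 (hz L (by linarith [hnn R])))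
    (sum_weights_nonneg hx0 (hz R (by linarith [hnn L])))

/-- The excess is that of a clique on `L`, so `R` has at most as many edges as `L` misses: each gain
of at least 1/4 pays for a loss of at most 1/16. -/
lemma eventually_hasComparison_of_caseB
    (hH : ∀ᶠ n in atTop, H n ∈ EXContaining (completeBipartiteGraph (Fin k) (Fin (n - k))) n ℱ)
    (hB : CaseB k H) : ∀ᶠ n in atTop, HasComparison ℱ k n := by
  have hb : ∀ᶠ n in atTop,
      2 * (edgeCount (H n) : ℝ) = 2 * (k * (n - k : ℕ)) + k * (k - 1) := by
    filter_upwards [hB] with n ⟨e⟩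
    rw [two_mul_edgeCount_of_iso e, sum_adjInd_graphJoin, sum_adjInd_top]
    simp [adjInd]
    ring
  filter_upwards [hH, hB, sum_adjInd_le_excess hH hb] with n hHn hBn hexc G hG x β L R hx0 hβ hL
    hxL hxR hR hRn
  obtain ⟨T, hT, hfull, hcl⟩ := exists_full_of_graphJoin hHn.1 hBn L hL
  refine ⟨T, hT, hfull, ?_⟩
  have h1 := hexc G hG L R hL hR hRn
  have h2 := le_sum_weights_clique (G := G) hcl hxL
  have hxR' : ∀ v ∈ R, x v ≤ 1 / 4 := fun v hv => (hxR v ((hR v).1 hv).1).trans hβ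
  have h3 := neg_le_sum_weights (G := G) (T := T) hx0 hxR'
  have h4 : 0 ≤ ∑ u ∈ R, ∑ v ∈ R, adjInd G u v :=
    Finset.sum_nonneg fun u _ => Finset.sum_nonneg fun v _ => adjInd_nonneg G u v
  rw [hL] at h2
  linarith

lemma eventually_hasComparison_of_caseC
    (hH : ∀ᶠ n in atTop, H n ∈ EXContaining (completeBipartiteGraph (Fin k) (Fin (n - k))) n ℱ)
    (hC : CaseC k H) : ∀ᶠ n in atTop, HasComparison ℱ k n := by
  have hb : ∀ᶠ n in atTop,
      2 * (edgeCount (H n) : ℝ) = 2 * (k * (n - k : ℕ)) + (k * (k - 1) + 2) := by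
    filter_upwards [hC, eventually_ge_atTop (k + 2)] with n ⟨e⟩ hn
    rw [two_mul_edgeCount_of_iso e, sum_adjInd_graphJoin, sum_adjInd_top, sum_adjInd_edge]
    have : Fintype.card (Fin 2 ⊕ Fin (n - k - 2)) = n - k := by simp; omega
    rw [this, Fintype.card_fin]
    ring
  filter_upwards [hH, hC, sum_adjInd_le_excess hH hb, eventually_ge_atTop 4]
    with n hHn hCn hexc hn4 G hG x β L R hx0 hβ hL hxL hxR hR hRn
  have h1 := hexc G hG L R hL hR hRn
  have hxR' : ∀ v ∈ R, x v ≤ 1 / 4 := fun v hv => (hxR v ((hR v).1 hv).1).trans hβ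
  have hRnn : 0 ≤ ∑ u ∈ R, ∑ v ∈ R, adjInd G u v :=
    Finset.sum_nonneg fun u _ => Finset.sum_nonneg fun v _ => adjInd_nonneg G u v
  have hLle := sum_adjInd_le_clique G L
  rw [hL] at hLle
  -- If `L` misses d ≥ 1 ordered pairs, then `R` has at most d + 2, and d/4 ≥ (d + 2)/16. If `L` is
  -- a clique, `R` spans at most one edge, and the extra edge of the comparison graph is placed
  -- exactly there.
  have hdich : ∑ u ∈ L, ∑ v ∈ L, adjInd G u v + 1 ≤ k * (k - 1) ∨
      ∑ u ∈ L, ∑ v ∈ L, adjInd G u v = k * (k - 1) := by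
    obtain ⟨N, hN⟩ := exists_nat_sum_adjInd G L
    obtain ⟨N', hN'⟩ := exists_nat_sum_adjInd (⊤ : SimpleGraph (Fin n)) L
    rw [sum_adjInd_clique (T := ⊤) (L := L) fun u _ v _ h => h, hL] at hN'
    rw [hN, hN'] at hLle ⊢
    norm_cast at hLle ⊢
    omega
  obtain ⟨p, hp, q, hq, hpq, hadj⟩ : ∃ p ∈ R, ∃ q ∈ R, p ≠ q ∧
      ((∃ u ∈ R, ∃ v ∈ R, G.Adj u v) → G.Adj p q) := by
    by_cases h : ∃ u ∈ R, ∃ v ∈ R, G.Adj u v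
    · obtain ⟨u, hu, v, hv, huv⟩ := h
      exact ⟨u, hu, v, hv, huv.ne, fun _ => huv⟩
    · obtain ⟨u, hu, v, hv, huv⟩ := Finset.one_lt_card.1 (by omega : 1 < R.card)
      exact ⟨u, hu, v, hv, huv, fun h' => absurd h' h⟩
  obtain ⟨T, hT, hfull, hcl, hTpq⟩ := exists_full_of_graphJoin_edge hHn.1 hCn L hL
    ((hR p).1 hp).1 ((hR q).1 hq).1 hpq
  refine ⟨T, hT, hfull, ?_⟩
  have h2 := le_sum_weights_clique (G := G) hcl hxL
  rw [hL] at h2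
  rcases hdich with hlt | heq
  · have h3 := neg_le_sum_weights (G := G) (T := T) hx0 hxR'
    linarith
  · have h3 : 0 ≤ ∑ u ∈ R, ∑ v ∈ R, (adjInd T u v - adjInd G u v) * (x u * x v) := by
      refine sum_weights_nonneg hx0 fun u hu v hv huv => ?_
      rcases eq_or_eq_of_sum_adjInd_le_two (by linarith) hp hq (hadj ⟨u, hu, v, hv, huv⟩)
        hu hv huv with ⟨rfl, rfl⟩ | ⟨rfl, rfl⟩
      exacts [hTpq, hTpq.symm]
    linarith

end Cases

/-! ### The main result -/

section Main

variable {ℱ : GraphFamily} {k : ℕ} {H : ∀ n, SimpleGraph (Fin n)}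

lemma eventually_sparsePerron (hk : 1 ≤ k)
    (hex : (fun n : ℕ => (exNumber n ℱ : ℝ)) =O[atTop] (fun n : ℕ => (n : ℝ)))
    (hK : ¬ FamilyFree ℱ (completeBipartiteGraph (Fin (k + 1)) ℕ))
    (hH : ∀ᶠ n in atTop,
      H n ∈ EXContaining (completeBipartiteGraph (Fin k) (Fin (n - k))) n ℱ) :
    ∃ (m : ℕ) (C : ℝ), 1 ≤ C ∧ ∀ᶠ n in atTop, ∀ G ∈ SPEX n ℱ, ∀ x : Fin n → ℝ,
      IsPerronVector G x → SparsePerron k m C G (lambdaOne G) x := by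
  obtain ⟨C, hC1, hC⟩ := exists_exNumber_le hex
  obtain ⟨m, hm⟩ := exists_common_lt hK
  refine ⟨m, C, hC1, ?_⟩
  filter_upwards [hH, eventually_gt_atTop k] with n hHn hn G hG x hx
  obtain ⟨heig, h0, h1, hz⟩ := (isPerronVector_iff G x).1 hx
  have hsqrt : √((k : ℝ) * (n - k)) ≤ lambdaOne G :=
    (sqrt_le_lambdaOne (H n) hn hk hHn.2.1).trans (hG.2 _ hHn.1)
  obtain ⟨hlam0, hlam⟩ := Real.sqrt_le_iff.1 hsqrt
  exact ⟨heig, h0, h1, hz, hlam0, by simpa using hlam, fun S => hG.1.sum_adjInd_le hC S,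
    hm G hG.1⟩

/-- The large entries of a Perron vector of a spectral extremal graph. -/
lemma eventually_large_entries_full (hk : 1 ≤ k) {m : ℕ} {C : ℝ} (hC : 1 ≤ C)
    (hP : ∀ᶠ n in atTop, ∀ G ∈ SPEX n ℱ, ∀ x : Fin n → ℝ,
      IsPerronVector G x → SparsePerron k m C G (lambdaOne G) x)
    (hcomp : ∀ᶠ n in atTop, HasComparison ℱ k n) {η : ℝ} (hη0 : 0 < η) (hη1 : η < 1) :
    ∀ᶠ n in atTop, ∀ G ∈ SPEX n ℱ, ∀ x : Fin n → ℝ, IsPerronVector G x →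
      {v | η ≤ x v}.ncard = k ∧ ∀ u v, η ≤ x u → x v < η → G.Adj u v := by
  have hk' : (1 : ℝ) ≤ k := by exact_mod_cast hk
  have hm0 : (0 : ℝ) ≤ m := by positivity
  -- The second bound gives α ≤ 1/4, 8Cα ≤ 1 and the smallness condition 2mα + 4Cα ≤ 1/2 of
  -- `full_of_comparison`.
  set α := min η (1 / (8 * (m + 2 * C))) with hα
  have hα0 : 0 < α := lt_min hη0 (by positivity)
  have hαC : 8 * (m + 2 * C) * α ≤ 1 := by
    calc 8 * (m + 2 * C) * α ≤ 8 * (m + 2 * C) * (1 / (8 * (m + 2 * C))) :=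
          mul_le_mul_of_nonneg_left (min_le_right _ _) (by positivity)
      _ = 1 := by field_simp
  have hmα : 0 ≤ m * α := by positivity
  have hCα : α ≤ C * α := le_mul_of_one_le_left hα0.le hC
  -- Entries at least α are at least 1 - δ ≥ η, so the thresholds α and η select the same vertices.
  -- The other bound leaves `L` at least n/2 common neighbours.
  set δ := min (1 - η) (1 / (2 * (k + 1))) with hδ
  have hδ0 : 0 < δ := lt_min (by linarith) (by positivity)
  have hδk : δ * (k + 1) ≤ 1 / 2 := by
    calc δ * (k + 1) ≤ 1 / (2 * (k + 1)) * (k + 1) :=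
          mul_le_mul_of_nonneg_right (min_le_right _ _) (by positivity)
      _ = 1 / 2 := by field_simp
  filter_upwards [hP, hcomp, eventually_large_entries hk m hC hα0 (by nlinarith) hδ0 hδk]
    with n hPn hcompn hlarge G hG x hx
  have h := hPn G hG x hx
  set L : Finset (Fin n) := Finset.univ.filter fun v => α ≤ x v with hL
  have hmemL : ∀ v, v ∈ L ↔ α ≤ x v := fun v => by simp [hL]
  obtain ⟨hLc, hL2⟩ := hlarge G _ x h L hmemL
  have hLx : ∀ v ∈ L, η ≤ x v := fun v hv => by
    linarith [(hL2 v hv).1, min_le_left (1 - η) (1 / (2 * ((k : ℝ) + 1)))]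
  have hLhalf : ∀ v ∈ L, 1 / 2 ≤ x v := fun v hv => by nlinarith [(hL2 v hv).1]
  have hset : {v | η ≤ x v} = (L : Set (Fin n)) := by
    ext v
    exact ⟨fun hv => (hmemL v).2 ((min_le_left _ _).trans hv), fun hv => hLx v hv⟩
  have hnotL : ∀ v ∉ L, x v ≤ α := fun v hv => by
    have := mt (hmemL v).2 hv
    linarith
  have hLne : L.Nonempty := Finset.card_pos.1 (by omega)
  classical
  set R : Finset (Fin n) := Finset.univ.filter fun v => ∀ u ∈ L, G.Adj u v with hR
  have hmemR : ∀ v, v ∈ R ↔ v ∉ L ∧ ∀ u ∈ L, G.Adj u v := fun v => by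
    simp only [hR, Finset.mem_filter, Finset.mem_univ, true_and, iff_and_self]
    exact fun hv hvL => G.loopless.irrefl v (hv v hvL)
  have hRn : n ≤ 2 * R.card := by
    have h1 := card_le_common_nbrs G L R (δ := δ) (fun u hu => by simpa [hR] using hu)
      fun t ht => by simpa using (hL2 t ht).2
    rw [hLc, Fintype.card_fin] at h1
    have h2 : (n : ℝ) ≤ 2 * R.card := by
      have h4 : (0 : ℝ) ≤ n := by positivity
      nlinarith
    exact_mod_cast h2
  -- The neighbours of `v` in `R` are common neighbours of the k+1 vertices of `L ∪ {v}`.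
  have hmR : ∀ v ∉ L, ∑ u ∈ R, adjInd G v u ≤ m := by
    intro v hv
    rw [sum_adjInd_eq_card]
    refine Nat.cast_le.2 (h.common (insert v L) _
      (by rw [Finset.card_insert_of_notMem hv, hLc]) fun t ht u hu => ?_).le
    rw [Finset.mem_filter] at hu
    rcases Finset.mem_insert.1 ht with rfl | ht
    · exact hu.2
    · exact ((hmemR u).1 hu.1).2 t ht
  obtain ⟨G', hG', hfull, hsum⟩ := hcompn G hG.1 x α L R h.nonneg (by nlinarith) hLc hLhalf hnotL
    hmemR hRn
  have hfin := full_of_comparison (hG.2 G' hG') h.eig h.nonneg h.sparse L R hLhalf hnotL hmemR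
    hmR hfull hsum (by nlinarith)
  refine ⟨by rw [hset, Set.ncard_coe_finset, hLc], fun u v hu hv => ?_⟩
  exact hfin u (hset ▸ hu : u ∈ (L : Set (Fin n))) v fun hvL => by linarith [hLx v hvL]

end Main

theorem proposition2p2 (ℱ : GraphFamily) (k : ℕ) (hk : 1 ≤ k)
    (hex : (fun n : ℕ => (exNumber n ℱ : ℝ)) =O[atTop] (fun n : ℕ => (n : ℝ)))
    (hK : ¬ FamilyFree ℱ (completeBipartiteGraph (Fin (k + 1)) ℕ))
    (H : ∀ n, SimpleGraph (Fin n))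
    (hH : ∀ᶠ n in atTop,
      H n ∈ EXContaining (completeBipartiteGraph (Fin k) (Fin (n - k))) n ℱ)
    (hcase : CaseA k H ∨ CaseB k H ∨ CaseC k H ∨ CaseD ℱ k H ∨ CaseE ℱ k H ∨ CaseF ℱ k H) :
    (∀ᶠ n in atTop, ∀ G ∈ SPEX n ℱ, completeBipartiteGraph (Fin k) (Fin (n - k)) ⊑ G) ∧
    (∀ η : ℝ, 0 < η → η < 1 → ∀ᶠ n in atTop, ∀ G ∈ SPEX n ℱ, ∀ x : Fin n → ℝ,
      IsPerronVector G x →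
        {v | η ≤ x v}.ncard = k ∧ ∀ u v, η ≤ x u → x v < η → G.Adj u v) := by
  have hcomp : ∀ᶠ n in atTop, HasComparison ℱ k n := by
    rcases hcase with h | h | h | h | h | h
    · exact eventually_hasComparison_of_caseA hH h
    · exact eventually_hasComparison_of_caseB hH h
    · exact eventually_hasComparison_of_caseC hH h
    all_goals exact eventually_hasComparison_of_finite h.1 k
  obtain ⟨m, C, hC, hP⟩ := eventually_sparsePerron hk hex hK hH
  have hmain := fun η (hη0 : 0 < η) (hη1 : η < 1) =>
    eventually_large_entries_full hk hC hP hcomp hη0 hη1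
  refine ⟨?_, hmain⟩
  filter_upwards [hmain (1 / 2) (by norm_num) (by norm_num), eventually_gt_atTop 0]
    with n hn hn0 G hG
  obtain ⟨x, hx⟩ := exists_isPerronVector G hn0
  obtain ⟨hcard, hfull⟩ := hn G hG x hx
  set L : Finset (Fin n) := Finset.univ.filter fun v => 1 / 2 ≤ x v with hL
  have hLc : L.card = k := by
    rw [← hcard, ← Set.ncard_coe_finset]
    congr 1
    ext v
    simp [hL]
  refine completeBipartiteGraph_isContained_of_full L hLc
    (by rw [Finset.card_compl, hLc, Fintype.card_fin]) fun u hu v hv => ?_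
  exact hfull u v (Finset.mem_filter.1 hu).2 (by simpa [hL] using hv)
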